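/- Let $R=k[x_1,\dots,x_n]$ be a polynomial ring over a field $k$, and let $I,J\subsetneq R$ be proper monomial ideals. Let $F$ and $G$ be minimal multigraded free resolutions of $R/I$ and $R/J$ with chosen multigraded bases; write $m_f$ for the multidegree (a monomial) of a basis element $f$ and $|f|$ for its homological degree, and write the differentials as $d(f)=\sum_a \alpha_{a,f}\frac{m_f}{m_a}a$ and $d(g)=\sum_b\beta_{b,g}\frac{m_g}{m_b}b$ with $\alpha_{a,f},\beta_{b,g}\in k$. The generalized Taylor complex $F*G$ is the complex of free $R$-modules with basis the symbols $f*g$, of homological degree $|f|+|g|$ and multidegree $m_{f*g}=\operatorname{lcm}(m_f,m_g)$, and with differential $$d(f*g)=\sum_a\alpha_{a,f}\frac{m_{f*g}}{m_{a*g}}\,a*g+(-1)^{|f|}\sum_b\beta_{b,g}\frac{m_{f*g}}{m_{f*b}}\,f*b .$$ Suppose that $I$ and $J$ are quasitransverse, i.e. $F*G$ is the minimal free resolution of $R/(I+J)$. Then $A=R/(I\cap J)$ is a Golod ring. Here Golod means the following. Let $\mathfrak m$ be the homogeneous maximal ideal of $A$ and $K$ the Koszul complex on a minimal system of generators of $\mathfrak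 m$. Then $K$ admits a trivial Massey operation: for some homogeneous $k$-basis $\mathcal B$ of $H_{\ge 1}(K)$ there is a function $\mu:\coprod_{p\ge1}\mathcal B^p\to K$, with $\mu(h_1,\dots,h_p)$ homogeneous of homological degree $|h_1|+\dots+|h_p|+p-1$, such that $\mu(h)$ is a cycle with homology class $h$ for each $h\in\mathcal B$, and $$d\,\mu(h_1,\dots,h_p)=\sum_{j=1}^{p-1}\overline{\mu(h_1,\dots,h_j)}\,\mu(h_{j+1},\dots,h_p),\qquad \overline{z}=(-1)^{|z|+1}z .$$ -/

import Mathlib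

open MvPolynomial

namespace Quasitransverse

universe u

noncomputable section

/-- An ideal of `k[x₁, …, xₙ]` generated by monomials. -/
def IsMonomialIdeal {n : ℕ} {k : Type u} [Field k] (I : Ideal (MvPolynomial (Fin n) k)) : Prop :=
  ∃ S : Set (Fin n →₀ ℕ), I = Ideal.span ((fun s => monomial s (1 : k)) '' S)

/-- A complex of multigraded free modules over `k[x₁, …, xₙ]`, with a chosen multigraded basis `B`
(the disjoint union of the bases of all homological degrees). The basis element `f` lies in
homological degree `hdeg f` and has as multidegree the monomial with exponent vector `mdeg f`.
The differential is `d f = ∑ₐ (coeff f a) (m_f / m_a) a` with scalars `coeff f a ∈ k`, where only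
`a` of homological degree one less and with `m_a ∣ m_f` occur. Since
`(m_f / m_a) (m_a / m_b) = m_f / m_b`, the condition `d ∘ d = 0` is a condition on the scalars. -/
structure MultigradedComplex (n : ℕ) (k : Type u) [Field k] where
  B : Type
  hdeg : B → ℕ
  mdeg : B → (Fin n →₀ ℕ)
  coeff : B → (B →₀ k)
  hdeg_of_coeff_ne_zero : ∀ f a, coeff f a ≠ 0 → hdeg f = hdeg a + 1
  mdeg_of_coeff_ne_zero : ∀ f a, coeff f a ≠ 0 → mdeg a ≤ mdeg f
  coeff_coeff : ∀ f, Finsupp.linearCombination k coeff (coeff f) = 0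

namespace MultigradedComplex

variable {n : ℕ} {k : Type u} [Field k]

/-- The underlying free module of the complex (the direct sum over all homological degrees). -/
abbrev FreeModule (F : MultigradedComplex n k) : Type u := F.B →₀ MvPolynomial (Fin n) k

/-- The differential, `d f = ∑ₐ (coeff f a) (m_f / m_a) a`. -/
def d (F : MultigradedComplex n k) : F.FreeModule →ₗ[MvPolynomial (Fin n) k] F.FreeModule :=
  Finsupp.linearCombination (MvPolynomial (Fin n) k) fun f =>
    (F.coeff f).sum fun a c => Finsupp.single a (monomial (F.mdeg f - F.mdeg a) c)

/-- The component of homological degree `i`: the free module on the basis elements of degree `i`. -/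
def component (F : MultigradedComplex n k) (i : ℕ) :
    Submodule (MvPolynomial (Fin n) k) F.FreeModule :=
  Finsupp.supported (MvPolynomial (Fin n) k) (MvPolynomial (Fin n) k) {f | F.hdeg f = i}

/-- `F` is a multigraded free resolution of `R ⧸ I`, where `R = k[x₁, …, xₙ]`: the homology of `F`
vanishes in positive homological degrees, and there is a multigraded surjection `ε : F₀ → R ⧸ I`
(extended by zero to positive homological degrees) whose kernel on `F₀` is the image of `d`.
That `ε` is multigraded means that it sends a basis element `f` of `F₀` to the class of a scalar
multiple of the monomial `m_f`. -/
def IsResolution (F : MultigradedComplex n k) (I : Ideal (MvPolynomial (Fin n) k)) : Prop :=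
  (∀ i, ∀ x ∈ F.component (i + 1), F.d x = 0 ↔ x ∈ LinearMap.range F.d) ∧
  ∃ ε : F.FreeModule →ₗ[MvPolynomial (Fin n) k] (MvPolynomial (Fin n) k ⧸ I),
    (∀ f, F.hdeg f ≠ 0 → ε (Finsupp.single f 1) = 0) ∧
    (∀ f, F.hdeg f = 0 → ∃ c : k,
      ε (Finsupp.single f 1) = Ideal.Quotient.mk I (monomial (F.mdeg f) c)) ∧
    Function.Surjective ε ∧
    ∀ x ∈ F.component 0, ε x = 0 ↔ x ∈ LinearMap.range F.d

/-- `F` is minimal: `d F ⊆ 𝔪 F`, with `𝔪 = (x₁, …, xₙ)`. -/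
def IsMinimal (F : MultigradedComplex n k) : Prop :=
  LinearMap.range F.d ≤
    idealOfVars (Fin n) k • (⊤ : Submodule (MvPolynomial (Fin n) k) F.FreeModule)

/-- `F` is a minimal multigraded free resolution of `R ⧸ I`. -/
def IsMinimalResolution (F : MultigradedComplex n k) (I : Ideal (MvPolynomial (Fin n) k)) : Prop :=
  F.IsResolution I ∧ F.IsMinimal

/-- The scalar part of the differential of `F * G` on the basis element `f * g`. -/
def taylorCoeff (F G : MultigradedComplex n k) (p : F.B × G.B) : (F.B × G.B) →₀ k :=
  (F.coeff p.1).mapDomain (fun a => (a, p.2)) +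
    (-1 : k) ^ F.hdeg p.1 • (G.coeff p.2).mapDomain (fun b => (p.1, b))

theorem taylorCoeff_apply_ne_zero (F G : MultigradedComplex n k) (p q : F.B × G.B)
    (h : taylorCoeff F G p q ≠ 0) :
    (F.coeff p.1 q.1 ≠ 0 ∧ q.2 = p.2) ∨ (q.1 = p.1 ∧ G.coeff p.2 q.2 ≠ 0) := by
  classical
  by_contra hc
  push Not at hc
  apply h
  obtain ⟨f, g⟩ := p
  obtain ⟨a, b⟩ := q
  have h1 : ((F.coeff f).mapDomain (fun a => (a, g))) (a, b) = 0 := by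
    by_cases hb : b = g
    · subst hb
      rw [Finsupp.mapDomain_apply (f := fun a => (a, b)) (fun x y hxy => (Prod.ext_iff.1 hxy).1)]
      by_contra h0
      exact hc.1 h0 rfl
    · exact Finsupp.mapDomain_of_notMem_range _ _ (by rintro ⟨x, hx⟩; exact hb (Prod.ext_iff.1 hx).2.symm)
  have h2 : ((G.coeff g).mapDomain (fun b => (f, b))) (a, b) = 0 := by
    by_cases ha : a = f
    · subst ha
      rw [Finsupp.mapDomain_apply (f := fun b => (a, b)) (fun x y hxy => (Prod.ext_iff.1 hxy).2)]
      exact hc.2 rfl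
    · exact Finsupp.mapDomain_of_notMem_range _ _ (by rintro ⟨x, hx⟩; exact ha (Prod.ext_iff.1 hx).1.symm)
  simp [taylorCoeff, h1, h2]

theorem taylorCoeff_taylorCoeff (F G : MultigradedComplex n k) (p : F.B × G.B) :
    Finsupp.linearCombination k (taylorCoeff F G) (taylorCoeff F G p) = 0 := by
  classical
  obtain ⟨f, g⟩ := p
  have e1 : Finsupp.linearCombination k (fun a => (F.coeff a).mapDomain fun c => (c, g))
      (F.coeff f) = 0 := by
    have := congrArg (Finsupp.lmapDomain k k fun c : F.B => (c, g)) (F.coeff_coeff f)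
    rw [Finsupp.apply_linearCombination, map_zero] at this
    exact this
  have e2 : Finsupp.linearCombination k (fun b => (G.coeff b).mapDomain fun c => (f, c))
      (G.coeff g) = 0 := by
    have := congrArg (Finsupp.lmapDomain k k fun c : G.B => (f, c)) (G.coeff_coeff g)
    rw [Finsupp.apply_linearCombination, map_zero] at this
    exact this
  have e3 : Finsupp.linearCombination k
        (fun a => (-1 : k) ^ F.hdeg a • (G.coeff g).mapDomain fun c => (a, c)) (F.coeff f) =
      -((-1 : k) ^ F.hdeg f • Finsupp.linearCombination k
        (fun b => (F.coeff f).mapDomain fun c => (c, b)) (G.coeff g)) := by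
    simp only [Finsupp.linearCombination_apply, Finsupp.mapDomain, Finsupp.sum, Finset.smul_sum,
      Finsupp.smul_single, ← Finset.sum_neg_distrib]
    rw [Finset.sum_comm]
    refine Finset.sum_congr rfl fun b _ => Finset.sum_congr rfl fun a ha => ?_
    rw [F.hdeg_of_coeff_ne_zero f a (Finsupp.mem_support_iff.1 ha), ← Finsupp.single_neg]
    congr 1
    simp only [smul_eq_mul, pow_succ]
    ring
  have s1 : Finsupp.linearCombination k (taylorCoeff F G) ((F.coeff f).mapDomain fun a => (a, g)) =
      Finsupp.linearCombination k (fun a => (F.coeff a).mapDomain fun c => (c, g)) (F.coeff f) +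
      Finsupp.linearCombination k
        (fun a => (-1 : k) ^ F.hdeg a • (G.coeff g).mapDomain fun c => (a, c)) (F.coeff f) := by
    rw [Finsupp.linearCombination_mapDomain]
    simp only [Finsupp.linearCombination_apply, ← Finsupp.sum_add, Function.comp_def, taylorCoeff,
      smul_add]
  have s2 : Finsupp.linearCombination k (taylorCoeff F G) ((G.coeff g).mapDomain fun b => (f, b)) =
      Finsupp.linearCombination k (fun b => (F.coeff f).mapDomain fun c => (c, b)) (G.coeff g) +
      (-1 : k) ^ F.hdeg f • Finsupp.linearCombination k
        (fun b => (G.coeff b).mapDomain fun c => (f, c)) (G.coeff g) := by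
    rw [Finsupp.linearCombination_mapDomain]
    simp only [Finsupp.linearCombination_apply, Function.comp_def, taylorCoeff, smul_add,
      Finsupp.sum_add, Finsupp.smul_sum]
    congr 1
    exact Finsupp.sum_congr fun b _ => smul_comm _ _ _
  simp only [taylorCoeff, map_add, map_smul]
  change Finsupp.linearCombination k (taylorCoeff F G) _ + _ • Finsupp.linearCombination k
    (taylorCoeff F G) _ = 0
  rw [s1, s2, e1, e2, e3]
  simp

/-- The generalized Taylor complex `F * G`: it has a basis element `f * g` for every pair of basis
elements `f` of `F` and `g` of `G`, of homological degree `|f| + |g|` and of multidegree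
`m_{f * g} = lcm (m_f, m_g)`, and its differential is
`d (f * g) = ∑ₐ α_{a,f} (m_{f*g} / m_{a*g}) a * g + (-1)^|f| ∑_b β_{b,g} (m_{f*g} / m_{f*b}) f * b`,
where `α` and `β` are the scalars in the differentials of `F` and `G`. -/
def taylor (F G : MultigradedComplex n k) : MultigradedComplex n k where
  B := F.B × G.B
  hdeg p := F.hdeg p.1 + G.hdeg p.2
  mdeg p := F.mdeg p.1 ⊔ G.mdeg p.2
  coeff := taylorCoeff F G
  hdeg_of_coeff_ne_zero p q h := by
    rcases taylorCoeff_apply_ne_zero F G p q h with ⟨h1, h2⟩ | ⟨h1, h2⟩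
    · have := F.hdeg_of_coeff_ne_zero _ _ h1
      rw [h2]; omega
    · have := G.hdeg_of_coeff_ne_zero _ _ h2
      rw [h1]; omega
  mdeg_of_coeff_ne_zero p q h := by
    rcases taylorCoeff_apply_ne_zero F G p q h with ⟨h1, h2⟩ | ⟨h1, h2⟩
    · exact sup_le_sup (F.mdeg_of_coeff_ne_zero _ _ h1) (by rw [h2])
    · exact sup_le_sup (by rw [h1]) (G.mdeg_of_coeff_ne_zero _ _ h2)
  coeff_coeff := taylorCoeff_taylorCoeff F G

end MultigradedComplex

/-- Monomial ideals `I` and `J` are quasitransverse if, for minimal multigraded free resolutions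
`F` of `R ⧸ I` and `G` of `R ⧸ J`, the generalized Taylor complex `F * G` is a minimal free
resolution of `R ⧸ (I + J)`. Minimal multigraded free resolutions exist and are unique up to
isomorphism, so it does not matter which `F` and `G` are used. -/
def IsQuasitransverse {n : ℕ} {k : Type u} [Field k] (I J : Ideal (MvPolynomial (Fin n) k)) :
    Prop :=
  IsMonomialIdeal I ∧ IsMonomialIdeal J ∧
    ∃ F G : MultigradedComplex n k, F.IsMinimalResolution I ∧ G.IsMinimalResolution J ∧
      (F.taylor G).IsMinimalResolution (I + J)

section Koszul

variable {A : Type u} [CommRing A] {r : ℕ} (a : Fin r → A)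

/-- The differential of the Koszul complex `K(a₁, …, a_r; A)`, whose underlying graded algebra is
the exterior algebra of `A^r`: contraction with the linear form `e_i ↦ a_i`. -/
def koszulD : ExteriorAlgebra A (Fin r → A) →ₗ[A] ExteriorAlgebra A (Fin r → A) :=
  CliffordAlgebra.contractLeft (Fintype.linearCombination A a)

/-- The cycles of the Koszul complex of homological degree `i`. -/
def koszulCycles (i : ℕ) : Submodule A (ExteriorAlgebra A (Fin r → A)) :=
  (⋀[A]^i (Fin r → A)) ⊓ LinearMap.ker (koszulD a)

/-- The boundaries of the Koszul complex of homological degree `i`. -/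
def koszulBoundaries (i : ℕ) : Submodule A (ExteriorAlgebra A (Fin r → A)) :=
  (⋀[A]^(i + 1) (Fin r → A)).map (koszulD a)

/-- The Koszul homology `H_i(a₁, …, a_r; A)`. -/
abbrev KoszulHomology (i : ℕ) : Type u :=
  koszulCycles a i ⧸ (koszulBoundaries a i).submoduleOf (koszulCycles a i)

/-- The homological degree of `μ (h₁, …, h_p)` for a Massey operation `μ`, which is
`|h₁| + … + |h_p| + p - 1`. A pair `⟨i, x⟩` stands for a basis element `h` with `|h| = i + 1`. -/
def masseyDegree {Λ : ℕ → Type u} (l : List (Σ i, Λ i)) : ℕ :=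
  (l.map fun h => h.1 + 1).sum + (l.length - 1)

/-- The Koszul complex `K` of `a₁, …, a_r` over the `k`-algebra `A` admits a trivial Massey
operation: for some homogeneous `k`-basis `ℬ` of the homology in positive degrees (indexed by
`Σ i, Λ i`, with `Λ i` indexing a basis of the homology in degree `i + 1`) there is a function `μ`
from nonempty finite sequences in `ℬ` to homogeneous elements of `K` such that `μ (h)` is a cycle
with class `h` and `d μ (h₁, …, h_p) = ∑ⱼ bar (μ (h₁, …, hⱼ)) μ (hⱼ₊₁, …, h_p)`, with `j` from `1`
to `p - 1` and `bar z = (-1)^(|z| + 1) z`. The value of `μ` at the empty list is irrelevant. -/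
def HasTrivialMasseyOperation (k : Type u) [Field k] [Algebra k A] : Prop :=
  ∃ (Λ : ℕ → Type u) (b : ∀ i, Module.Basis (Λ i) k (KoszulHomology a (i + 1)))
    (μ : List (Σ i, Λ i) → ExteriorAlgebra A (Fin r → A)),
    (∀ l, l ≠ [] → μ l ∈ ⋀[A]^(masseyDegree l) (Fin r → A)) ∧
    (∀ h : Σ i, Λ i, ∃ hz : μ [h] ∈ koszulCycles a (h.1 + 1),
      Submodule.Quotient.mk ⟨μ [h], hz⟩ = b h.1 h.2) ∧
    ∀ l, l ≠ [] → koszulD a (μ l) = ∑ j ∈ Finset.Ico 1 l.length,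
      (-1 : A) ^ (masseyDegree (l.take j) + 1) • (μ (l.take j) * μ (l.drop j))

end Koszul

/-- The Golod property of a `k`-algebra `A` with distinguished maximal ideal `𝔪` with residue field
`k` (here: a standard graded algebra with its homogeneous maximal ideal): the Koszul complex on a
minimal system of generators of `𝔪` admits a trivial Massey operation. -/
def IsGolodRing (k : Type u) [Field k] (A : Type u) [CommRing A] [Algebra k A] (𝔪 : Ideal A) :
    Prop :=
  Function.Bijective (algebraMap k (A ⧸ 𝔪)) ∧
  ∃ a : Fin 𝔪.spanFinrank → A, Ideal.span (Set.range a) = 𝔪 ∧ HasTrivialMasseyOperation a k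

end

end Quasitransverse

/-! Put `L = I ⊓ J`, `A = R/L`, `𝔞 = I/L` and `𝔟 = J/L`, so that `𝔞 𝔟 = 0`. The claim reduces to
this: every cycle of positive degree in the Koszul complex `K` of `A` becomes a boundary modulo `𝔞`
and also modulo `𝔟`. Each homology class `h` then has a representative `z h` in `𝔞 K` and an element
`w h` with `d (w h) ≡ -z h` modulo `𝔟 K`. As `𝔞 𝔟 = 0`, the products `z h₁ * w h₂ * ⋯ * w h_p` form
a trivial Massey operation (`koszulD_mul_prod`, `hasTrivialMasseyOperation_of_mul_eq_bot`).

Quasitransversality enters through multidegrees. Minimality of `F * G` forces `m_f ∉ J` for every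
basis element `f` of `F`, and symmetrically `m_g ∉ I` (`monomial_mdeg_notMem_right`,
`monomial_mdeg_notMem_left`). Lift a Koszul cycle of `A` to `z` over `R` and look at multidegree
`m`. If `x^m ∉ J`, the boundary of `z`, having coefficients in `J`, vanishes there; so `z` is a
cycle over `R`, hence a boundary. If `x^m ∈ J`, no basis element of `F` has multidegree `m`, so `Tor
(R/I, k)` vanishes in multidegree `m` and `z` is a boundary modulo `I`. The second case is a diagram
chase in the tensor product of `F` with the Koszul complex (`exists_eq_scalarD_add_modelD`); both
cases are joined in `exists_sub_modelD_mem`.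

The same multidegree condition shows that no variable lies in `L`, so the images of the variables
generate the maximal ideal minimally. -/

namespace Quasitransverse

universe u

noncomputable section

/-! ### Koszul complexes with arbitrary coefficients, in coordinates. -/

section CochainModel

variable {n : ℕ}

/-- The sign of moving `e_i` past the `e_j` with `j ∈ S` and `j < i`. -/
def koszulSign (i : Fin n) (S : Finset (Fin n)) : ℤ := (-1) ^ (S.filter (· < i)).card

theorem koszulSign_mul_self (i : Fin n) (S : Finset (Fin n)) :
    koszulSign i S * koszulSign i S = 1 := by
  rw [koszulSign, ← mul_pow]; simp

theorem koszulSign_insert {i j : Fin n} {S : Finset (Fin n)} (hj : j ∉ S) :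
    koszulSign i (insert j S) = if j < i then -koszulSign i S else koszulSign i S := by
  unfold koszulSign
  rw [Finset.filter_insert]
  split_ifs with h
  · rw [Finset.card_insert_of_notMem (by simp [hj]), pow_succ]; ring
  · rfl

theorem koszulSign_comm {i j : Fin n} {S : Finset (Fin n)} (hij : i ≠ j) (hi : i ∉ S)
    (hj : j ∉ S) :
    koszulSign i (insert j S) * koszulSign j S = -(koszulSign j (insert i S) * koszulSign i S) := by
  rw [koszulSign_insert hj, koszulSign_insert hi]
  rcases lt_or_gt_of_ne hij with h | h
  · simp [h, h.not_gt]; ring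
  · simp [h, h.not_gt]; ring

theorem koszulSign_swap {i j : Fin n} {S : Finset (Fin n)} (hij : i ≠ j) (hi : i ∉ S)
    (hj : j ∉ S) :
    koszulSign i S * koszulSign j (insert i S) = -(koszulSign j S * koszulSign i (insert j S)) := by
  linarith [koszulSign_comm hij hi hj, mul_comm (koszulSign i S) (koszulSign j (insert i S)),
    mul_comm (koszulSign j S) (koszulSign i (insert j S))]

variable (A : Type*) {V : Type*} [CommRing A] [AddCommGroup V] [Module A V]

/-- Contraction with the `i`-th coordinate form on `V ⊗ Λ(Aⁿ)`, an element of which is written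
as the family of its coefficients. -/
def lower (i : Fin n) : (Finset (Fin n) → V) →ₗ[A] (Finset (Fin n) → V) where
  toFun z T := if i ∈ T then 0 else koszulSign i T • z (insert i T)
  map_add' x y := by ext T; by_cases h : i ∈ T <;> simp [h]
  map_smul' c x := by ext T; by_cases h : i ∈ T <;> simp [h, smul_comm c]

/-- Left multiplication by `e_i` on `V ⊗ Λ(Aⁿ)`. -/
def raise (i : Fin n) : (Finset (Fin n) → V) →ₗ[A] (Finset (Fin n) → V) where
  toFun z S := if i ∈ S then koszulSign i (S.erase i) • z (S.erase i) else 0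
  map_add' x y := by ext T; by_cases h : i ∈ T <;> simp [h]
  map_smul' c x := by ext T; by_cases h : i ∈ T <;> simp [h, smul_comm c]

variable {A}

theorem lower_apply (i : Fin n) (z : Finset (Fin n) → V) (T : Finset (Fin n)) :
    lower A i z T = if i ∈ T then 0 else koszulSign i T • z (insert i T) := rfl

theorem raise_apply (i : Fin n) (z : Finset (Fin n) → V) (S : Finset (Fin n)) :
    raise A i z S = if i ∈ S then koszulSign i (S.erase i) • z (S.erase i) else 0 := rfl

theorem lower_raise_self (i : Fin n) (z : Finset (Fin n) → V) :
    lower A i (raise A i z) + raise A i (lower A i z) = z := by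
  ext S
  by_cases h : i ∈ S <;> simp [lower_apply, raise_apply, h, smul_smul, koszulSign_mul_self]

theorem lower_raise_of_ne {i j : Fin n} (hij : i ≠ j) (z : Finset (Fin n) → V) :
    lower A i (raise A j z) + raise A j (lower A i z) = 0 := by
  ext S
  by_cases hi : i ∈ S
  · simp [lower_apply, raise_apply, hi, hij]
  by_cases hj : j ∈ S
  · obtain ⟨T, hT, rfl⟩ : ∃ T, j ∉ T ∧ insert j T = S :=
      ⟨S.erase j, by simp, Finset.insert_erase hj⟩
    have hiT : i ∉ T := fun h => hi (Finset.mem_insert_of_mem h)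
    have hji : j ∉ insert i T := by simp [hT, hij.symm]
    have hiT' : i ∉ insert j T := hi
    simp only [lower_apply, raise_apply, Pi.add_apply, hiT', if_false, Finset.insert_comm i j,
      Finset.mem_insert_self, if_true, Finset.erase_insert hji, Finset.erase_insert hT, hiT,
      smul_smul, Pi.zero_apply]
    rw [koszulSign_insert hiT, koszulSign_insert hT]
    rcases lt_or_gt_of_ne hij with h | h
    · simp [h, h.not_gt, mul_comm]
    · simp [h, h.not_gt, mul_comm]
  · simp [lower_apply, raise_apply, hi, hj, hij.symm]

theorem raise_raise_self (i : Fin n) (z : Finset (Fin n) → V) : raise A i (raise A i z) = 0 := by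
  ext S
  simp [raise_apply]

theorem lower_lower_self (i : Fin n) (z : Finset (Fin n) → V) : lower A i (lower A i z) = 0 := by
  ext S
  simp [lower_apply]

theorem lower_lower_comm (i j : Fin n) (z : Finset (Fin n) → V) :
    lower A i (lower A j z) + lower A j (lower A i z) = 0 := by
  by_cases hij : i = j
  · subst hij; simp [lower_lower_self]
  ext S
  by_cases hi : i ∈ S
  · simp [lower_apply, hi]
  by_cases hj : j ∈ S
  · simp [lower_apply, hj]
  have hij' : j ≠ i := Ne.symm hij
  simp [lower_apply, hi, hj, hij, hij', smul_smul, koszulSign_swap hij hi hj,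
    Finset.insert_comm i j]

theorem raise_raise_comm (i j : Fin n) (z : Finset (Fin n) → V) :
    raise A i (raise A j z) + raise A j (raise A i z) = 0 := by
  by_cases hij : i = j
  · subst hij; simp [raise_raise_self]
  have hij' : j ≠ i := Ne.symm hij
  ext S
  by_cases hi : i ∈ S
  swap
  · simp [raise_apply, hi]
  by_cases hj : j ∈ S
  swap
  · simp [raise_apply, hj]
  obtain ⟨T, hT, rfl⟩ : ∃ T, j ∉ T ∧ insert j T = S :=
      ⟨S.erase j, by simp, Finset.insert_erase hj⟩
  have hiT : i ∈ T := by simpa [hij] using hi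
  obtain ⟨U, hU, rfl⟩ : ∃ U, i ∉ U ∧ insert i U = T :=
      ⟨T.erase i, by simp, Finset.insert_erase hiT⟩
  have hjU : j ∉ U := fun h => hT (Finset.mem_insert_of_mem h)
  have h1 : (insert j (insert i U)).erase j = insert i U := Finset.erase_insert hT
  have h2 : (insert j (insert i U)).erase i = insert j U := by
    rw [Finset.insert_comm]; exact Finset.erase_insert (by simp [hU, hij])
  simp [raise_apply, h1, h2, Finset.erase_insert hU, Finset.erase_insert hjU, smul_smul,
    koszulSign_comm hij hU hjU]

/-- The differential of the Koszul complex of `a₁, …, aₙ` with coefficients in `V`. -/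
def modelD (a : Fin n → A) : (Finset (Fin n) → V) →ₗ[A] (Finset (Fin n) → V) :=
  ∑ i, a i • lower A i

theorem modelD_apply (a : Fin n → A) (z : Finset (Fin n) → V) (T : Finset (Fin n)) :
    modelD a z T = ∑ i, a i • lower A i z T := by
  simp [modelD]

/-- Multiplication by `e_i` is a homotopy between `a i` and zero. Where `a i` acts as `1`, it
contracts the complex. -/
theorem modelD_raise (a : Fin n → A) (i : Fin n) (z : Finset (Fin n) → V) :
    modelD a (raise A i z) = a i • z - raise A i (modelD a z) := by
  rw [eq_sub_iff_add_eq]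
  simp only [modelD, LinearMap.sum_apply, LinearMap.smul_apply, map_sum, map_smul,
    ← Finset.sum_add_distrib, ← smul_add]
  rw [Finset.sum_eq_single i]
  · rw [lower_raise_self]
  · intro j _ hj
    rw [lower_raise_of_ne hj, smul_zero]
  · simp

theorem modelD_modelD (a : Fin n → A) (z : Finset (Fin n) → V) : modelD a (modelD a z) = 0 := by
  simp only [modelD, LinearMap.sum_apply, LinearMap.smul_apply, map_sum, map_smul, Finset.smul_sum]
  rw [← Finset.sum_product']
  refine Finset.sum_involution (fun p _ => (p.2, p.1)) ?_ ?_ (by simp) (by simp)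
  · rintro ⟨i, j⟩ -
    simp only
    rw [smul_comm, ← smul_add, ← smul_add, lower_lower_comm, smul_zero, smul_zero]
  · rintro ⟨i, j⟩ - h he
    obtain rfl : j = i := congrArg Prod.fst he
    exact h (by simp [lower_lower_self])

/-- The Koszul differential is natural in the coefficients. -/
theorem modelD_comp {A' V' : Type*} [CommRing A'] [AddCommGroup V'] [Module A' V'] (a : Fin n → A)
    (a' : Fin n → A') (φ : V →+ V') (h : ∀ i v, φ (a i • v) = a' i • φ v)
    (z : Finset (Fin n) → V) (T : Finset (Fin n)) :
    modelD a' (fun S => φ (z S)) T = φ (modelD a z T) := by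
  simp only [modelD_apply, map_sum, h, lower_apply]
  refine Finset.sum_congr rfl fun i _ => ?_
  split_ifs <;> simp

end CochainModel

/-! ### Comparison of the exterior algebra with its coordinates. -/

section ExteriorModel

variable {n : ℕ} {A : Type*} [CommRing A]

/-- The family of coefficients of the unit of the exterior algebra. -/
def modelOne : Finset (Fin n) → A := Pi.single ∅ 1

/-- Left multiplication by a vector. -/
def raiseVec : (Fin n → A) →ₗ[A] Module.End A (Finset (Fin n) → A) :=
  Fintype.linearCombination A (fun i => raise A i)

theorem raiseVec_apply (v : Fin n → A) (z : Finset (Fin n) → A) :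
    raiseVec v z = ∑ i, v i • raise A i z := by
  simp [raiseVec, Fintype.linearCombination_apply]

/-- The relation needed to let the exterior algebra act on coefficient families; the terms `(i, j)`
and `(j, i)` cancel. -/
theorem raiseVec_mul_self (v : Fin n → A) : raiseVec v * raiseVec v = 0 := by
  refine LinearMap.ext fun z => ?_
  simp only [Module.End.mul_apply, raiseVec_apply, map_sum, map_smul,
    Finset.smul_sum, LinearMap.zero_apply]
  rw [← Finset.sum_product']
  refine Finset.sum_involution (fun p _ => (p.2, p.1)) ?_ ?_ (by simp) (by simp)
  · rintro ⟨i, j⟩ -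
    simp only
    rw [smul_comm, ← smul_add, ← smul_add, raise_raise_comm, smul_zero, smul_zero]
  · rintro ⟨i, j⟩ - h he
    obtain rfl : j = i := congrArg Prod.fst he
    exact h (by simp [raise_raise_self])

/-- The family of coefficients of an element of the exterior algebra. -/
def toModel : ExteriorAlgebra A (Fin n → A) →ₗ[A] (Finset (Fin n) → A) :=
  (LinearMap.applyₗ modelOne) ∘ₗ
    (ExteriorAlgebra.lift A ⟨raiseVec, raiseVec_mul_self⟩).toLinearMap

theorem toModel_ι_mul (v : Fin n → A) (x : ExteriorAlgebra A (Fin n → A)) :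
    toModel (ExteriorAlgebra.ι A v * x) = raiseVec v (toModel x) := by
  simp [toModel]

theorem toModel_algebraMap (c : A) :
    toModel (algebraMap A (ExteriorAlgebra A (Fin n → A)) c) = c • modelOne := by
  simp [toModel, Algebra.algebraMap_eq_smul_one]

theorem exterior_left_induction {P : ExteriorAlgebra A (Fin n → A) → Prop}
    (algebraMap : ∀ c : A, P (algebraMap A _ c)) (add : ∀ x y, P x → P y → P (x + y))
    (mul : ∀ (v : Fin n → A) x, P x → P (ExteriorAlgebra.ι A v * x)) (x) : P x :=
  CliffordAlgebra.left_induction _ algebraMap add (fun x v h => mul v x h) x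

theorem exteriorPower_zero : ⋀[A]^0 (Fin n → A) = 1 := pow_zero _

theorem exteriorPower_succ (q : ℕ) : ⋀[A]^(q + 1) (Fin n → A) =
    LinearMap.range (ExteriorAlgebra.ι A (M := Fin n → A)) * ⋀[A]^q (Fin n → A) := pow_succ' _ _

theorem koszulD_algebraMap (a : Fin n → A) (c : A) :
    koszulD a (algebraMap A (ExteriorAlgebra A (Fin n → A)) c) = 0 :=
  CliffordAlgebra.contractLeft_algebraMap ..

theorem koszulD_ι_mul (a v : Fin n → A) (x : ExteriorAlgebra A (Fin n → A)) :
    koszulD a (ExteriorAlgebra.ι A v * x) =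
      (∑ i, v i * a i) • x - ExteriorAlgebra.ι A v * koszulD a x := by
  rw [koszulD, ExteriorAlgebra.ι]
  erw [CliffordAlgebra.contractLeft_ι_mul]
  simp only [Fintype.linearCombination_apply, smul_eq_mul]

theorem koszulD_koszulD (a : Fin n → A) (x : ExteriorAlgebra A (Fin n → A)) :
    koszulD a (koszulD a x) = 0 :=
  CliffordAlgebra.contractLeft_contractLeft ..

theorem modelD_raiseVec (a v : Fin n → A) (z : Finset (Fin n) → A) :
    modelD a (raiseVec v z) = (∑ i, v i * a i) • z - raiseVec v (modelD a z) := by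
  simp only [raiseVec_apply, map_sum, map_smul, modelD_raise, Finset.sum_smul, smul_sub, smul_smul,
    Finset.sum_sub_distrib]

theorem modelD_modelOne (a : Fin n → A) : modelD a (modelOne : Finset (Fin n) → A) = 0 := by
  ext T
  simp [modelD_apply, lower_apply, modelOne]

theorem toModel_koszulD (a : Fin n → A) (x : ExteriorAlgebra A (Fin n → A)) :
    toModel (koszulD a x) = modelD a (toModel x) := by
  induction x using exterior_left_induction with
  | algebraMap c => simp [koszulD_algebraMap, toModel_algebraMap, modelD_modelOne]
  | add x y hx hy => simp [hx, hy]
  | mul v x hx =>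
    rw [koszulD_ι_mul, map_sub, map_smul, toModel_ι_mul, toModel_ι_mul, modelD_raiseVec, hx]

/-- The product of the `e_i` with `i ∈ S`, in increasing order. -/
def basisWedge (S : Finset (Fin n)) : ExteriorAlgebra A (Fin n → A) :=
  ((S.sort (· ≤ ·)).map fun i => ExteriorAlgebra.ι A (Pi.single i 1)).prod

theorem basisWedge_insert {i : Fin n} {S : Finset (Fin n)} (h : ∀ j ∈ S, i < j) :
    (basisWedge (insert i S) : ExteriorAlgebra A (Fin n → A)) =
      ExteriorAlgebra.ι A (Pi.single i 1) * basisWedge S := by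
  rw [basisWedge, Finset.sort_insert (r := (· ≤ ·)) (fun j hj => (h j hj).le)
    (fun hi => (h i hi).ne rfl)]
  simp [basisWedge]

/-- The element of the exterior algebra with given coefficients. -/
def ofModel : (Finset (Fin n) → A) →ₗ[A] ExteriorAlgebra A (Fin n → A) :=
  Fintype.linearCombination A basisWedge

theorem ofModel_single (S : Finset (Fin n)) (c : A) :
    ofModel (Pi.single S c) = c • (basisWedge S : ExteriorAlgebra A (Fin n → A)) := by
  simp [ofModel]

theorem raise_single_of_mem {i : Fin n} {S : Finset (Fin n)} (h : i ∈ S) :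
    raise A i (Pi.single S (1 : A)) = 0 := by
  ext T
  rw [raise_apply]
  split_ifs with hi
  · rw [Pi.single_eq_of_ne, smul_zero]; rfl
    rintro rfl
    simp at h
  · rfl

theorem raise_single_of_notMem {i : Fin n} {S : Finset (Fin n)} (h : i ∉ S) :
    raise A i (Pi.single S (1 : A)) = koszulSign i S • Pi.single (insert i S) (1 : A) := by
  ext T
  rw [raise_apply, Pi.smul_apply]
  by_cases hT : T = insert i S
  · subst hT; simp [Finset.erase_insert h]
  · rw [Pi.single_eq_of_ne hT, smul_zero]
    split_ifs with hi
    · rw [Pi.single_eq_of_ne, smul_zero]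
      rintro rfl
      exact hT (Finset.insert_erase hi).symm
    · rfl

theorem single_insert_eq_raise {i : Fin n} {S : Finset (Fin n)} (h : ∀ j ∈ S, i < j) :
    (Pi.single (insert i S) 1 : Finset (Fin n) → A) = raise A i (Pi.single S 1) := by
  have hs : koszulSign i S = 1 := by
    rw [koszulSign, Finset.filter_eq_empty_iff.2 (fun j hj => (h j hj).not_gt)]; simp
  rw [raise_single_of_notMem (fun hi => (h i hi).ne rfl), hs, one_smul]

/-- Basis wedges are sorted products. With `j` the least element, `e_i` goes in front if `i < j`,
both sides vanish if `i = j`, and otherwise `e_i` anticommutes past `e_j` and induction applies. -/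
theorem ofModel_raise_single (i : Fin n) (S : Finset (Fin n)) :
    ofModel (raise A i (Pi.single S 1)) =
      ExteriorAlgebra.ι A (Pi.single i 1) * (basisWedge S : ExteriorAlgebra A (Fin n → A)) := by
  induction S using Finset.induction_on_min generalizing i with
  | empty =>
    rw [← single_insert_eq_raise (by simp), ofModel_single, one_smul, basisWedge_insert (by simp)]
  | insert j S hS ih =>
    rcases lt_trichotomy i j with hij | rfl | hij
    · have h : ∀ l ∈ insert j S, i < l := by
        intro l hl
        rcases Finset.mem_insert.1 hl with rfl | hl
        · exact hij
        · exact hij.trans (hS l hl)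
      rw [← single_insert_eq_raise h, ofModel_single, one_smul, basisWedge_insert h]
    · rw [single_insert_eq_raise hS, raise_raise_self, map_zero, basisWedge_insert hS, ← mul_assoc,
        ExteriorAlgebra.ι_sq_zero, zero_mul]
    · rw [single_insert_eq_raise hS, basisWedge_insert hS, ← mul_assoc,
        eq_neg_of_add_eq_zero_left (raise_raise_comm (A := A) (V := A) i j _),
        eq_neg_of_add_eq_zero_left (ExteriorAlgebra.ι_add_mul_swap (R := A) (Pi.single i 1 : Fin n → A)
          (Pi.single j 1)), map_neg, neg_mul, mul_assoc, ← ih]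
      by_cases hi : i ∈ S
      · simp [raise_single_of_mem hi]
      · have h : ∀ l ∈ insert i S, j < l := by
          intro l hl
          rcases Finset.mem_insert.1 hl with rfl | hl
          · exact hij
          · exact hS l hl
        rw [raise_single_of_notMem hi, map_zsmul, map_zsmul, map_zsmul, ofModel_single, one_smul,
          ← single_insert_eq_raise h, ofModel_single, one_smul, basisWedge_insert h, mul_smul_comm]

theorem model_induction {P : (Finset (Fin n) → A) → Prop}
    (add : ∀ x y, P x → P y → P (x + y)) (smul : ∀ (c : A) x, P x → P (c • x))
    (single : ∀ S, P (Pi.single S 1)) (x : Finset (Fin n) → A) : P x := by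
  have h : x ∈ Submodule.span A (Set.range fun S => (Pi.single S 1 : Finset (Fin n) → A)) := by
    have := (Pi.basisFun A (Finset (Fin n))).span_eq
    have he : (Set.range fun S => (Pi.single S 1 : Finset (Fin n) → A)) =
      Set.range (Pi.basisFun A (Finset (Fin n))) := by
      congr 1; ext S; simp
    rw [he, this]; trivial
  induction h using Submodule.span_induction with
  | mem x h => obtain ⟨S, rfl⟩ := h; exact single S
  | zero => simpa using smul 0 _ (single ∅)
  | add x y _ _ hx hy => exact add x y hx hy
  | smul c x _ hx => exact smul c x hx

theorem ofModel_raise (i : Fin n) (z : Finset (Fin n) → A) :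
    ofModel (raise A i z) = ExteriorAlgebra.ι A (Pi.single i 1) * ofModel z := by
  induction z using model_induction with
  | add x y hx hy => simp [hx, hy, mul_add]
  | smul c x hx => simp [hx]
  | single S => rw [ofModel_raise_single, ofModel_single, one_smul]

theorem ofModel_raiseVec (v : Fin n → A) (z : Finset (Fin n) → A) :
    ofModel (raiseVec v z) = ExteriorAlgebra.ι A v * ofModel z := by
  conv_rhs => rw [← Finset.univ_sum_single v]
  simp only [raiseVec_apply, map_sum, map_smul, ofModel_raise, Finset.sum_mul]
  refine Finset.sum_congr rfl fun i _ => ?_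
  rw [← smul_mul_assoc, ← map_smul, ← Pi.single_smul, smul_eq_mul, mul_one]

/-- This composite lets a computation in coordinates be carried back to the exterior algebra. -/
theorem ofModel_toModel (x : ExteriorAlgebra A (Fin n → A)) : ofModel (toModel x) = x := by
  induction x using exterior_left_induction with
  | algebraMap c =>
    rw [toModel_algebraMap, map_smul, modelOne, ofModel_single, one_smul,
      Algebra.algebraMap_eq_smul_one]
    simp [basisWedge]
  | add x y hx hy => simp [hx, hy]
  | mul v x hx => rw [toModel_ι_mul, ofModel_raiseVec, hx]

theorem koszulD_ofModel (a : Fin n → A) (z : Finset (Fin n) → A) :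
    koszulD a (ofModel z) = ofModel (modelD a z) := by
  induction z using model_induction with
  | add x y hx hy => simp [hx, hy]
  | smul c x hx => simp [hx]
  | single S =>
    induction S using Finset.induction_on_min with
    | empty =>
      rw [← modelOne, modelD_modelOne, map_zero, modelOne, ofModel_single, one_smul]
      simpa [basisWedge] using koszulD_algebraMap a 1
    | insert j S hS ih =>
      rw [single_insert_eq_raise hS, ofModel_raise, koszulD_ι_mul, ih, modelD_raise, map_sub,
        ofModel_raise, map_smul]
      simp [Pi.single_apply]

theorem basisWedge_mem (S : Finset (Fin n)) :
    (basisWedge S : ExteriorAlgebra A (Fin n → A)) ∈ ⋀[A]^S.card (Fin n → A) := by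
  induction S using Finset.induction_on_min with
  | empty => simp [basisWedge]
  | insert j S hS ih =>
    rw [basisWedge_insert hS, Finset.card_insert_of_notMem (fun h => (hS j h).ne rfl), exteriorPower_succ]
    exact Submodule.mul_mem_mul ⟨_, rfl⟩ ih

theorem ofModel_mem {q : ℕ} {z : Finset (Fin n) → A} (hz : ∀ S, z S ≠ 0 → S.card = q) :
    ofModel z ∈ ⋀[A]^q (Fin n → A) := by
  rw [ofModel, Fintype.linearCombination_apply]
  refine Submodule.sum_mem _ fun S _ => ?_
  by_cases h : z S = 0
  · simp [h]
  · rw [← hz S h]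
    exact Submodule.smul_mem _ _ (basisWedge_mem S)

theorem card_of_toModel_ne_zero {q : ℕ} {x : ExteriorAlgebra A (Fin n → A)}
    (hx : x ∈ ⋀[A]^q (Fin n → A)) : ∀ S, toModel x S ≠ 0 → S.card = q := by
  induction q generalizing x with
  | zero =>
    rw [exteriorPower_zero, Submodule.mem_one] at hx
    obtain ⟨c, rfl⟩ := hx
    intro S hS
    rw [toModel_algebraMap] at hS
    by_contra h
    exact hS (by simp [modelOne, Finset.card_ne_zero.1 h |>.ne_empty])
  | succ q ih =>
    rw [exteriorPower_succ] at hx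
    induction hx using Submodule.mul_induction_on' with
    | mem_mul_mem v hv y hy =>
      obtain ⟨v, rfl⟩ := hv
      intro S hS
      rw [toModel_ι_mul, raiseVec_apply, Finset.sum_apply] at hS
      obtain ⟨i, -, hi⟩ := Finset.exists_ne_zero_of_sum_ne_zero hS
      rw [Pi.smul_apply, raise_apply] at hi
      split_ifs at hi with h
      · have := ih hy (S.erase i) (fun h0 => hi (by simp [h0]))
        rw [← this, Finset.card_erase_add_one h]
      · simp at hi
    | add x _ y _ hx hy =>
      intro S hS
      by_cases h : toModel x S = 0
      · exact hy S (fun h0 => hS (by simp [h, h0]))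
      · exact hx S h

theorem ofModel_mem_smul_top {𝔞 : Ideal A} {z : Finset (Fin n) → A} (hz : ∀ S, z S ∈ 𝔞) :
    ofModel z ∈ 𝔞 • (⊤ : Submodule A (ExteriorAlgebra A (Fin n → A))) := by
  rw [ofModel, Fintype.linearCombination_apply]
  exact Submodule.sum_mem _ fun S _ => Submodule.smul_mem_smul (hz S) trivial

end ExteriorModel

/-! ### Membership in monomial ideals. -/

section Monomial

variable {n : ℕ} {k : Type u} [Field k] {I J : Ideal (MvPolynomial (Fin n) k)}

theorem monomial_mem_of_le {s t : Fin n →₀ ℕ} (hst : s ≤ t) {b : k} (hb : b ≠ 0)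
    (hs : monomial s b ∈ I) (c : k) : monomial t c ∈ I := by
  have : monomial t c = monomial (t - s) (c * b⁻¹) * monomial s b := by
    rw [monomial_mul, tsub_add_cancel_of_le hst, inv_mul_cancel_right₀ hb]
  rw [this]
  exact I.mul_mem_left _ hs

/-- Membership is decided term by term, which is what allows working in one multidegree at a time.
-/
theorem IsMonomialIdeal.mem_iff (hI : IsMonomialIdeal I) (p : MvPolynomial (Fin n) k) :
    p ∈ I ↔ ∀ t, coeff t p ≠ 0 → monomial t (1 : k) ∈ I := by
  constructor
  · intro hp t ht
    obtain ⟨S, rfl⟩ := hI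
    obtain ⟨s, hs, hst⟩ := mem_ideal_span_monomial_image.1 hp t (mem_support_iff.2 ht)
    have h : monomial s (1 : k) ∈ Ideal.span ((fun s => monomial s (1 : k)) '' S) :=
      Ideal.subset_span (Set.mem_image_of_mem _ hs)
    exact monomial_mem_of_le hst one_ne_zero h 1
  · intro h
    rw [p.as_sum]
    exact Ideal.sum_mem _ fun t ht => monomial_mem_of_le le_rfl one_ne_zero (h t (mem_support_iff.1 ht)) _

theorem IsMonomialIdeal.coeff_zero (hI : IsMonomialIdeal I) (hI' : I ≠ ⊤)
    {p : MvPolynomial (Fin n) k} (hp : p ∈ I) : coeff 0 p = 0 := by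
  by_contra h
  exact hI' ((Ideal.eq_top_iff_one I).2 ((hI.mem_iff p).1 hp 0 h))

theorem coeff_zero_of_mem_idealOfVars {p : MvPolynomial (Fin n) k}
    (hp : p ∈ idealOfVars (Fin n) k) : coeff 0 p = 0 := by
  rw [← pow_one (idealOfVars (Fin n) k), mem_pow_idealOfVars_iff'] at hp
  exact hp 0 (by simp)

end Monomial

/-! ### Homogeneous strands of a multigraded complex and of its augmentation. -/

namespace MultigradedComplex

variable {n : ℕ} {k : Type u} [Field k] (F : MultigradedComplex n k)

/-- The differential on the scalar parts: `f ↦ ∑ₐ (coeff f a) a`. -/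
def scalarD : (F.B →₀ k) →ₗ[k] (F.B →₀ k) := Finsupp.linearCombination k F.coeff

theorem scalarD_single (f : F.B) (c : k) :
    F.scalarD (Finsupp.single f c) = c • F.coeff f := by
  simp [scalarD]

theorem scalarD_scalarD (y : F.B →₀ k) : F.scalarD (F.scalarD y) = 0 := by
  induction y using Finsupp.induction_linear with
  | zero => simp
  | add x y hx hy => simp [hx, hy]
  | single f c =>
    rw [scalarD_single, map_smul, scalarD, F.coeff_coeff, smul_zero]

theorem exists_of_scalarD_ne_zero {y : F.B →₀ k} {a : F.B} (h : F.scalarD y a ≠ 0) :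
    ∃ f, y f ≠ 0 ∧ F.coeff f a ≠ 0 := by
  rw [scalarD, Finsupp.linearCombination_apply, Finsupp.sum, Finsupp.finsetSum_apply] at h
  obtain ⟨f, -, hf⟩ := Finset.exists_ne_zero_of_sum_ne_zero h
  refine ⟨f, fun h0 => hf (by simp [h0]), fun h0 => hf (by simp [h0])⟩

/-- The part of multidegree `s` of the complex: the scalar parts that are supported on basis
elements of homological degree `p` and of multidegree dividing `s`. -/
def SupportedIn (p : ℕ) (s : Fin n →₀ ℕ) (y : F.B →₀ k) : Prop :=
  ∀ f, y f ≠ 0 → F.hdeg f = p ∧ F.mdeg f ≤ s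

variable {F}

theorem SupportedIn.scalarD {p : ℕ} {s : Fin n →₀ ℕ} {y : F.B →₀ k}
    (hy : F.SupportedIn (p + 1) s y) : F.SupportedIn p s (F.scalarD y) := by
  intro a ha
  obtain ⟨f, hf, hfa⟩ := F.exists_of_scalarD_ne_zero ha
  have h1 := F.hdeg_of_coeff_ne_zero f a hfa
  have h2 := hy f hf
  exact ⟨by omega, (F.mdeg_of_coeff_ne_zero f a hfa).trans h2.2⟩

theorem supportedIn_zero (p : ℕ) (s : Fin n →₀ ℕ) : F.SupportedIn p s 0 :=
  fun _ h => absurd rfl h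

variable (F)

/-- The scalar parts of the component of multidegree `s` of an element. -/
def strand (s : Fin n →₀ ℕ) : F.FreeModule →ₗ[k] (F.B →₀ k) :=
  Finsupp.lsum k fun f => Finsupp.lsingle f ∘ₗ
    (open Classical in if F.mdeg f ≤ s then lcoeff k (s - F.mdeg f) else 0)

/-- The homogeneous element of multidegree `s` with given scalar parts. -/
def ofStrand (s : Fin n →₀ ℕ) : (F.B →₀ k) →ₗ[k] F.FreeModule :=
  Finsupp.lsum k fun f => Finsupp.lsingle f ∘ₗ monomial (s - F.mdeg f)

theorem strand_single_of_le {s : Fin n →₀ ℕ} {f : F.B} (h : F.mdeg f ≤ s)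
    (p : MvPolynomial (Fin n) k) :
    F.strand s (Finsupp.single f p) = Finsupp.single f (MvPolynomial.coeff (s - F.mdeg f) p) := by
  simp [strand, h]

theorem strand_single_of_not_le {s : Fin n →₀ ℕ} {f : F.B} (h : ¬ F.mdeg f ≤ s)
    (p : MvPolynomial (Fin n) k) : F.strand s (Finsupp.single f p) = 0 := by
  simp [strand, h]

theorem ofStrand_single (s : Fin n →₀ ℕ) (f : F.B) (c : k) :
    F.ofStrand s (Finsupp.single f c) = Finsupp.single f (monomial (s - F.mdeg f) c) := by
  simp [ofStrand]

theorem d_single (f : F.B) (p : MvPolynomial (Fin n) k) :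
    F.d (Finsupp.single f p) = (F.coeff f).sum fun a c =>
      Finsupp.single a (p * monomial (F.mdeg f - F.mdeg a) c) := by
  simp [d, Finsupp.smul_sum]

theorem coeff_eq_sum (f : F.B) : F.coeff f = (F.coeff f).sum Finsupp.single :=
  (Finsupp.sum_single _).symm

theorem strand_apply_of_le {s : Fin n →₀ ℕ} {f : F.B} (h : F.mdeg f ≤ s) (x : F.FreeModule) :
    F.strand s x f = MvPolynomial.coeff (s - F.mdeg f) (x f) := by
  induction x using Finsupp.induction_linear with
  | zero => simp
  | add x y hx hy => simp [hx, hy]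
  | single g p =>
    by_cases hg : F.mdeg g ≤ s
    · rw [strand_single_of_le F hg]
      by_cases hgf : g = f
      · subst hgf; simp
      · simp [Finsupp.single_eq_of_ne' hgf]
    · rw [strand_single_of_not_le F hg]
      have hgf : g ≠ f := by rintro rfl; exact hg h
      simp [Finsupp.single_eq_of_ne' hgf]

theorem mdeg_le_of_strand_ne_zero {s : Fin n →₀ ℕ} {f : F.B} {x : F.FreeModule}
    (h : F.strand s x f ≠ 0) : F.mdeg f ≤ s := by
  by_contra hf
  apply h
  clear h
  induction x using Finsupp.induction_linear with
  | zero => simp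
  | add x y hx hy => simp [hx, hy]
  | single g p =>
    by_cases hg : F.mdeg g ≤ s
    · rw [strand_single_of_le F hg]
      have hgf : g ≠ f := by rintro rfl; exact hf hg
      simp [Finsupp.single_eq_of_ne' hgf]
    · simp [strand_single_of_not_le F hg]

theorem strand_d (s : Fin n →₀ ℕ) (x : F.FreeModule) :
    F.strand s (F.d x) = F.scalarD (F.strand s x) := by
  induction x using Finsupp.induction_linear with
  | zero => simp
  | add x y hx hy => simp [hx, hy]
  | single f p =>
    rw [d_single, Finsupp.sum, map_sum]
    by_cases hf : F.mdeg f ≤ s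
    · rw [strand_single_of_le F hf, scalarD_single]
      conv_rhs => rw [F.coeff_eq_sum f, Finsupp.sum, Finset.smul_sum]
      refine Finset.sum_congr rfl fun a ha => ?_
      have hle := F.mdeg_of_coeff_ne_zero f a (Finsupp.mem_support_iff.1 ha)
      rw [strand_single_of_le F (hle.trans hf), coeff_mul_monomial',
        if_pos (tsub_le_tsub_right hf _), tsub_tsub_tsub_cancel_right hle, Finsupp.smul_single,
        smul_eq_mul]
    -- A nonzero contribution to multidegree `s` would need `m_f / m_a` to divide `x^s / m_a`, hence
    -- `m_f ∣ x^s`.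
    · rw [strand_single_of_not_le F hf, map_zero]
      refine Finset.sum_eq_zero fun a ha => ?_
      have hle := F.mdeg_of_coeff_ne_zero f a (Finsupp.mem_support_iff.1 ha)
      by_cases has : F.mdeg a ≤ s
      · rw [strand_single_of_le F has, coeff_mul_monomial', if_neg, Finsupp.single_zero]
        intro h
        have h' := add_le_add_left h (F.mdeg a)
        rw [tsub_add_cancel_of_le hle, tsub_add_cancel_of_le has] at h'
        exact hf h'
      · exact strand_single_of_not_le F has _

variable {F}

theorem strand_ofStrand {s : Fin n →₀ ℕ} {y : F.B →₀ k} (hy : ∀ f, y f ≠ 0 → F.mdeg f ≤ s) :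
    F.strand s (F.ofStrand s y) = y := by
  conv_lhs => rw [← Finsupp.sum_single y]
  conv_rhs => rw [← Finsupp.sum_single y]
  simp only [Finsupp.sum, map_sum, ofStrand_single]
  refine Finset.sum_congr rfl fun f hf => ?_
  rw [strand_single_of_le F (hy f (Finsupp.mem_support_iff.1 hf)), coeff_monomial, if_pos rfl]

theorem d_ofStrand {s : Fin n →₀ ℕ} {y : F.B →₀ k} (hy : ∀ f, y f ≠ 0 → F.mdeg f ≤ s) :
    F.d (F.ofStrand s y) = F.ofStrand s (F.scalarD y) := by
  rw [← Finsupp.sum_single y]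
  simp only [Finsupp.sum, map_sum, ofStrand_single, scalarD_single]
  refine Finset.sum_congr rfl fun f hf => ?_
  rw [d_single]
  conv_rhs => rw [F.coeff_eq_sum f]
  simp only [Finsupp.sum, map_sum, map_smul, ofStrand_single]
  rw [Finset.smul_sum]
  refine Finset.sum_congr rfl fun a ha => ?_
  have hle := F.mdeg_of_coeff_ne_zero f a (Finsupp.mem_support_iff.1 ha)
  rw [monomial_mul, tsub_add_tsub_cancel (hy f (Finsupp.mem_support_iff.1 hf)) hle,
    Finsupp.smul_single, smul_monomial, smul_eq_mul]

theorem ofStrand_apply (s : Fin n →₀ ℕ) (y : F.B →₀ k) (f : F.B) :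
    F.ofStrand s y f = monomial (s - F.mdeg f) (y f) := by
  induction y using Finsupp.induction_linear with
  | zero => simp
  | add x y hx hy => simp [hx, hy]
  | single g c =>
    rw [ofStrand_single]
    by_cases h : g = f
    · subst h; simp
    · simp [Finsupp.single_eq_of_ne' h]

theorem ofStrand_mem_component {p : ℕ} {s : Fin n →₀ ℕ} {y : F.B →₀ k}
    (hy : F.SupportedIn p s y) : F.ofStrand s y ∈ F.component p := by
  refine (Finsupp.mem_supported' _ _).2 fun f hf => ?_
  rw [ofStrand_apply]
  by_contra h
  exact hf (hy f fun h0 => h (by simp [h0])).1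

theorem scalarD_filter (p : ℕ) (y : F.B →₀ k) :
    F.scalarD (Finsupp.filter (fun f => F.hdeg f = p + 1) y) = 
      Finsupp.filter (fun a => F.hdeg a = p) (F.scalarD y) := by
  induction y using Finsupp.induction_linear with
  | zero => simp only [Finsupp.filter_zero, map_zero]
  | add x y hx hy => simp only [Finsupp.filter_add, map_add, hx, hy]
  | single f c =>
    rw [scalarD_single]
    by_cases hf : F.hdeg f = p + 1
    · rw [Finsupp.filter_single_of_pos (fun f => F.hdeg f = p + 1) hf, scalarD_single, (Finsupp.filter_eq_self_iff _ _).2]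
      intro a ha
      have := F.hdeg_of_coeff_ne_zero f a fun h0 => ha (by simp [h0])
      omega
    · rw [Finsupp.filter_single_of_neg (fun f => F.hdeg f = p + 1) hf, map_zero, eq_comm, Finsupp.filter_eq_zero_iff]
      intro a ha
      by_contra h0
      have := F.hdeg_of_coeff_ne_zero f a fun h => h0 (by simp [h])
      omega

/-- A preimage can be made homogeneous, since projecting to multidegree `s` and then to homological
degree `p + 1` is compatible with the differential. -/
theorem exists_scalarD_eq_of_mem_range {p : ℕ} {s : Fin n →₀ ℕ} {y : F.B →₀ k}
    (hy : F.SupportedIn p s y) (h : F.ofStrand s y ∈ LinearMap.range F.d) :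
    ∃ y', F.SupportedIn (p + 1) s y' ∧ F.scalarD y' = y := by
  obtain ⟨u, hu⟩ := h
  refine ⟨Finsupp.filter (fun f => F.hdeg f = p + 1) (F.strand s u), fun f hf => ?_, ?_⟩
  · by_cases h : F.hdeg f = p + 1
    · rw [Finsupp.filter_apply_pos (fun f => F.hdeg f = p + 1) _ h] at hf
      exact ⟨h, F.mdeg_le_of_strand_ne_zero hf⟩
    · exact absurd (Finsupp.filter_apply_neg (fun f => F.hdeg f = p + 1) _ h) hf
  · rw [scalarD_filter, ← strand_d, hu, strand_ofStrand fun f hf => (hy f hf).2,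
      (Finsupp.filter_eq_self_iff _ _).2 fun f hf => (hy f hf).1]

variable {I : Ideal (MvPolynomial (Fin n) k)}

theorem IsResolution.exact (hF : F.IsResolution I) {p : ℕ} {s : Fin n →₀ ℕ} {y : F.B →₀ k}
    (hy : F.SupportedIn (p + 1) s y) (h : F.scalarD y = 0) :
    ∃ y', F.SupportedIn (p + 2) s y' ∧ F.scalarD y' = y := by
  refine exists_scalarD_eq_of_mem_range hy ((hF.1 p _ (ofStrand_mem_component hy)).1 ?_)
  rw [d_ofStrand fun f hf => (hy f hf).2, h, map_zero]

/-- The augmentation of a resolution of `R ⧸ I`, on scalar parts. -/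
theorem IsResolution.exists_augmentation (hF : F.IsResolution I) (hI : IsMonomialIdeal I)
    (hI' : I ≠ ⊤) : ∃ η : (F.B →₀ k) →ₗ[k] k,
      (∃ e, F.hdeg e = 0 ∧ F.mdeg e = 0 ∧ η (Finsupp.single e 1) ≠ 0) ∧
      ∀ s y, F.SupportedIn 0 s y → (monomial s (η y) ∈ I ↔
        ∃ y', F.SupportedIn 1 s y' ∧ F.scalarD y' = y) := by
  obtain ⟨-, ε, h1, h2, h3, h4⟩ := hF
  have h5 : ∀ f, ∃ c : k, (ε (Finsupp.single f 1) =
      Ideal.Quotient.mk I (monomial (F.mdeg f) c)) ∧ (F.hdeg f ≠ 0 → c = 0) := by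
    intro f
    by_cases hf : F.hdeg f = 0
    · obtain ⟨c, hc⟩ := h2 f hf
      exact ⟨c, hc, fun h => absurd hf h⟩
    · exact ⟨0, by simp [h1 f hf], fun _ => rfl⟩
  choose c hc hc0 using h5
  have hε : ε = (Ideal.Quotient.mkₐ (MvPolynomial (Fin n) k) I).toLinearMap ∘ₗ
      Finsupp.linearCombination (MvPolynomial (Fin n) k) fun f => monomial (F.mdeg f) (c f) := by
    ext f
    simp [hc]
  have hlift : ∀ s y, F.SupportedIn 0 s y → ε (F.ofStrand s y) =
      Ideal.Quotient.mk I (monomial s (Finsupp.linearCombination k c y)) := by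
    intro s y hy
    rw [hε]
    simp only [LinearMap.comp_apply, AlgHom.toLinearMap_apply, Ideal.Quotient.mkₐ_eq_mk]
    congr 1
    conv_lhs => rw [← Finsupp.sum_single y]
    rw [Finsupp.linearCombination_apply k]
    simp only [Finsupp.sum, map_sum, ofStrand_single, Finsupp.linearCombination_single]
    refine Finset.sum_congr rfl fun f hf => ?_
    rw [smul_eq_mul, monomial_mul, tsub_add_cancel_of_le (hy f (Finsupp.mem_support_iff.1 hf)).2,
      smul_eq_mul]
  refine ⟨Finsupp.linearCombination k c, ?_, fun s y hy => ?_⟩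
  -- A lift of `1` along `ε` must produce the constant term `1`, as elements of `I` have none. Only
  -- a basis element of degree and multidegree zero with nonzero scalar can do so.
  · by_contra! hno
    obtain ⟨u, hu⟩ := h3 1
    rw [hε] at hu
    simp only [LinearMap.comp_apply, AlgHom.toLinearMap_apply, Ideal.Quotient.mkₐ_eq_mk] at hu
    rw [← map_one (Ideal.Quotient.mk I), Ideal.Quotient.eq] at hu
    have hc1 := hI.coeff_zero hI' hu
    rw [coeff_sub, coeff_zero_one, sub_eq_zero, Finsupp.linearCombination_apply, Finsupp.sum,
      coeff_sum] at hc1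
    refine one_ne_zero (hc1.symm.trans (Finset.sum_eq_zero fun f _ => ?_))
    by_cases hf : F.hdeg f = 0
    · by_cases hm : F.mdeg f = 0
      · have := hno f hf hm
        simp only [Finsupp.linearCombination_single, one_smul] at this
        simp [this]
      · rw [smul_eq_mul, coeff_mul_monomial', if_neg (by simpa using hm)]
    · simp [hc0 f hf]
  · rw [← Ideal.Quotient.eq_zero_iff_mem, ← hlift s y hy, h4 _ (ofStrand_mem_component hy)]
    refine ⟨exists_scalarD_eq_of_mem_range hy, ?_⟩
    rintro ⟨y', hy', rfl⟩
    exact ⟨F.ofStrand s y', d_ofStrand fun f hf => (hy' f hf).2⟩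

/-- With equal multidegrees, the coefficient of `a` in `d f` would be a nonzero constant, outside
the ideal of the variables. -/
theorem IsMinimal.mdeg_ne (hF : F.IsMinimal) {f a : F.B} (h : F.coeff f a ≠ 0) :
    F.mdeg a ≠ F.mdeg f := by
  intro he
  have h1 : F.d (Finsupp.single f 1) ∈
    idealOfVars (Fin n) k • (⊤ : Submodule (MvPolynomial (Fin n) k) F.FreeModule) :=
    hF ⟨_, rfl⟩
  have h2 : ∀ x ∈ idealOfVars (Fin n) k • (⊤ : Submodule (MvPolynomial (Fin n) k) F.FreeModule),
      MvPolynomial.coeff 0 (x a) = 0 := by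
    intro x hx
    induction hx using Submodule.smul_induction_on' with
    | smul r hr y _ =>
      refine coeff_zero_of_mem_idealOfVars ?_
      exact Ideal.mul_mem_right _ _ hr
    | add x _ y _ hx hy => simp [hx, hy]
  have h3 := h2 _ h1
  have h4 := F.strand_apply_of_le he.le (F.d (Finsupp.single f 1))
  rw [he, tsub_self, h3, strand_d, strand_single_of_le F le_rfl, scalarD_single, tsub_self,
    coeff_zero_one, one_smul] at h4
  exact h h4

end MultigradedComplex

/-! ### The tensor product of a resolution with the Koszul complex, in a fixed multidegree. -/

section Strand

variable {n : ℕ}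

/-- The exponent vector of the squarefree monomial with support `S`. -/
def squarefreeExp (S : Finset (Fin n)) : Fin n →₀ ℕ :=
  Finsupp.equivFunOnFinite.symm fun i => if i ∈ S then 1 else 0

theorem squarefreeExp_apply (S : Finset (Fin n)) (i : Fin n) :
    squarefreeExp S i = if i ∈ S then 1 else 0 := rfl

theorem squarefreeExp_insert {S : Finset (Fin n)} {i : Fin n} (h : i ∉ S) :
    squarefreeExp (insert i S) = squarefreeExp S + Finsupp.single i 1 := by
  ext j
  simp only [squarefreeExp_apply, Finsupp.add_apply, Finset.mem_insert, Finsupp.single_apply]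
  by_cases hj : j = i
  · subst hj; simp [h]
  · simp [hj, Ne.symm hj]

theorem squarefreeExp_mono {S T : Finset (Fin n)} (h : S ⊆ T) :
    squarefreeExp S ≤ squarefreeExp T := by
  intro j
  simp only [squarefreeExp_apply]
  split_ifs with h1 h2
  · exact le_rfl
  · exact absurd (h h1) h2
  · exact Nat.zero_le _
  · exact le_rfl

variable {k : Type u} [Field k]

theorem exists_insert_of_modelD_ne_zero {A V : Type*} [CommRing A] [AddCommGroup V] [Module A V]
    {a : Fin n → A} {z : Finset (Fin n) → V} {T : Finset (Fin n)} (h : modelD a z T ≠ 0) :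
    ∃ i ∉ T, z (insert i T) ≠ 0 := by
  rw [modelD_apply] at h
  obtain ⟨i, -, hi⟩ := Finset.exists_ne_zero_of_sum_ne_zero h
  by_cases hT : i ∈ T
  · simp [lower_apply, hT] at hi
  · exact ⟨i, hT, fun h0 => hi (by simp [lower_apply, h0])⟩

/-- Exactness of the Koszul complex of the variables, in multidegree `s`. -/
theorem exists_modelD_eq {s : Fin n →₀ ℕ} {q : ℕ} {z : Finset (Fin n) → k}
    (hz : ∀ S, z S ≠ 0 → S.card = q ∧ squarefreeExp S ≤ s) (hd : modelD (1 : Fin n → k) z = 0)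
    (hq : q ≠ 0 ∨ s ≠ 0) :
    ∃ w : Finset (Fin n) → k, (∀ S, w S ≠ 0 → S.card = q + 1 ∧ squarefreeExp S ≤ s) ∧
      modelD (1 : Fin n → k) w = z := by
  by_cases h0 : z = 0
  · exact ⟨0, fun S h => absurd rfl h, by simp [h0]⟩
  obtain ⟨i, hi⟩ : ∃ i, s i ≠ 0 := by
    rcases hq with hq | hs
    · obtain ⟨S, hS⟩ := Function.ne_iff.1 h0
      obtain ⟨hc, hle⟩ := hz S hS
      obtain ⟨i, hi⟩ := Finset.card_pos.1 (by omega : 0 < S.card)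
      refine ⟨i, fun h => ?_⟩
      have := hle i
      simp [squarefreeExp_apply, hi, h] at this
    · exact Finsupp.ne_iff.1 hs
  -- On scalar parts each variable acts as `1`, so multiplying a cycle by `e_i` gives a preimage. It
  -- stays in multidegree `s` because `s i ≥ 1`.
  refine ⟨raise k i z, fun S hS => ?_, by simp [modelD_raise, hd]⟩
  rw [raise_apply] at hS
  split_ifs at hS with hiS
  · obtain ⟨hc, hle⟩ := hz (S.erase i) fun h => hS (by simp [h])
    refine ⟨by rw [← hc, Finset.card_erase_add_one hiS], fun j => ?_⟩
    have := hle j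
    simp only [squarefreeExp_apply, Finset.mem_erase] at this ⊢
    by_cases hj : j = i
    · subst hj; simp [hiS]; omega
    · simpa [hj] using this
  · exact absurd rfl hS

namespace MultigradedComplex

variable (F : MultigradedComplex n k)

/-- Multidegree `m` and bidegree `(p, q)` of the tensor product of `F` with the Koszul complex of
the variables, on scalar parts. -/
def InBidegree (m : Fin n →₀ ℕ) (p q : ℕ) (z : Finset (Fin n) → F.B →₀ k) : Prop :=
  ∀ S f, z S f ≠ 0 → S.card = q ∧ F.hdeg f = p ∧ F.mdeg f + squarefreeExp S ≤ m

variable {F}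
variable {m : Fin n →₀ ℕ} {p q : ℕ}

theorem InBidegree.supportedIn {z : Finset (Fin n) → F.B →₀ k} (hz : F.InBidegree m p q z)
    (S : Finset (Fin n)) : F.SupportedIn p (m - squarefreeExp S) (z S) := fun f hf =>
  ⟨(hz S f hf).2.1, le_tsub_of_add_le_right (hz S f hf).2.2⟩

theorem InBidegree.of_ne_zero {z : Finset (Fin n) → F.B →₀ k} (hz : F.InBidegree m p q z)
    {S : Finset (Fin n)} (h : z S ≠ 0) : S.card = q ∧ squarefreeExp S ≤ m := by
  obtain ⟨f, hf⟩ := Finsupp.ne_iff.1 h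
  obtain ⟨h1, -, h2⟩ := hz S f hf
  exact ⟨h1, le_trans le_add_self h2⟩

theorem inBidegree_of_supportedIn {z : Finset (Fin n) → F.B →₀ k}
    (h1 : ∀ S, z S ≠ 0 → S.card = q ∧ squarefreeExp S ≤ m)
    (h2 : ∀ S, F.SupportedIn p (m - squarefreeExp S) (z S)) : F.InBidegree m p q z := by
  intro S f hf
  obtain ⟨hc, hS⟩ := h1 S fun h => hf (by simp [h])
  exact ⟨hc, (h2 S f hf).1, add_le_of_le_tsub_right_of_le hS (h2 S f hf).2⟩

theorem inBidegree_zero : F.InBidegree m p q 0 := fun _ _ h => absurd rfl h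

theorem modelD_apply_apply (z : Finset (Fin n) → F.B →₀ k) (f : F.B) (T : Finset (Fin n)) :
    modelD (1 : Fin n → k) (fun S => z S f) T = modelD (1 : Fin n → k) z T f :=
  modelD_comp (1 : Fin n → k) (1 : Fin n → k) (Finsupp.applyAddHom f) (by simp) z T

theorem InBidegree.modelD {z : Finset (Fin n) → F.B →₀ k} (hz : F.InBidegree m p (q + 1) z) :
    F.InBidegree m p q (modelD (1 : Fin n → k) z) := by
  intro T f hf
  rw [← modelD_apply_apply] at hf
  obtain ⟨i, hi, h⟩ := exists_insert_of_modelD_ne_zero hf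
  obtain ⟨h1, h2, h3⟩ := hz _ _ h
  rw [Finset.card_insert_of_notMem hi] at h1
  exact ⟨by omega, h2, le_trans (add_le_add_right
    (squarefreeExp_mono (Finset.subset_insert i T)) _) h3⟩

theorem InBidegree.scalarD {z : Finset (Fin n) → F.B →₀ k} (hz : F.InBidegree m (p + 1) q z) :
    F.InBidegree m p q (fun S => F.scalarD (z S)) :=
  inBidegree_of_supportedIn (fun S hS => hz.of_ne_zero (S := S) fun h => hS (by simp [h]))
    fun S => (hz.supportedIn S).scalarD

theorem InBidegree.sub {y z : Finset (Fin n) → F.B →₀ k} (hy : F.InBidegree m p q y)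
    (hz : F.InBidegree m p q z) : F.InBidegree m p q (y - z) := by
  intro S f hf
  by_cases h : y S f = 0
  · exact hz S f fun h0 => hf (by simp [h, h0])
  · exact hy S f h

theorem modelD_scalarD (z : Finset (Fin n) → F.B →₀ k) (T : Finset (Fin n)) :
    modelD (1 : Fin n → k) (fun S => F.scalarD (z S)) T =
      F.scalarD (modelD (1 : Fin n → k) z T) :=
  modelD_comp (1 : Fin n → k) (1 : Fin n → k) F.scalarD.toAddMonoidHom (by simp) z T

/-- In the Koszul direction the tensor product splits over the basis elements `f` into Koszul
strands of multidegree `m - m_f`. Such a strand has homology only for `q = 0` and `m_f = m`. -/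
theorem InBidegree.exists_modelD_eq {z : Finset (Fin n) → F.B →₀ k} (hz : F.InBidegree m p q z)
    (hd : Quasitransverse.modelD (1 : Fin n → k) z = 0)
    (hq : q ≠ 0 ∨ ∀ f, F.hdeg f = p → F.mdeg f ≠ m) :
    ∃ w, F.InBidegree m p (q + 1) w ∧ Quasitransverse.modelD (1 : Fin n → k) w = z := by
  -- The last clause keeps the support in `f` finite when the choices are assembled.
  have key : ∀ f, ∃ w : Finset (Fin n) → k,
      (∀ S, w S ≠ 0 → S.card = q + 1 ∧ F.hdeg f = p ∧ F.mdeg f + squarefreeExp S ≤ m) ∧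
      Quasitransverse.modelD (1 : Fin n → k) w = (fun S => z S f) ∧
      ((fun S => z S f) = 0 → w = 0) := by
    intro f
    by_cases h0 : (fun S => z S f) = 0
    · exact ⟨0, fun S h => absurd rfl h, by simp [h0], fun _ => rfl⟩
    obtain ⟨S₀, hS₀⟩ := Function.ne_iff.1 h0
    obtain ⟨-, hp, hle⟩ := hz S₀ f hS₀
    have hfm : F.mdeg f ≤ m := le_trans le_self_add hle
    obtain ⟨w, hw, hdw⟩ := Quasitransverse.exists_modelD_eq (s := m - F.mdeg f) (q := q)
      (z := fun S => z S f)
      (fun S hS => ⟨(hz S f hS).1, le_tsub_of_add_le_left (hz S f hS).2.2⟩)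
      (by ext T; rw [modelD_apply_apply, hd]; rfl)
      (hq.imp id fun h h1 => h f hp (le_antisymm hfm (tsub_eq_zero_iff_le.1 h1)))
    exact ⟨w, fun S hS => ⟨(hw S hS).1, hp, add_le_of_le_tsub_left_of_le hfm (hw S hS).2⟩, hdw,
      fun h => absurd h h0⟩
  choose w hw hdw hw0 using key
  classical
  refine ⟨fun S => Finsupp.onFinset (Finset.univ.biUnion fun T => (z T).support)
    (fun f => w f S) ?_, fun S f hf => hw f S hf, ?_⟩
  · intro f hf
    by_contra h
    simp only [Finset.mem_biUnion, Finset.mem_univ, true_and, not_exists,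
      Finsupp.notMem_support_iff] at h
    exact hf (by rw [hw0 f (funext h)]; rfl)
  · ext T f
    rw [← modelD_apply_apply]
    exact congrFun (hdw f) T

variable {I J : Ideal (MvPolynomial (Fin n) k)}

theorem IsResolution.exists_scalarD_eq (hF : F.IsResolution I) {z : Finset (Fin n) → F.B →₀ k}
    (hz : F.InBidegree m (p + 1) q z) (hd : ∀ S, F.scalarD (z S) = 0) :
    ∃ w, F.InBidegree m (p + 2) q w ∧ ∀ S, F.scalarD (w S) = z S := by
  have key : ∀ S, ∃ w, F.SupportedIn (p + 2) (m - squarefreeExp S) w ∧ F.scalarD w = z S ∧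
      (z S = 0 → w = 0) := by
    intro S
    by_cases h : z S = 0
    · exact ⟨0, supportedIn_zero _ _, by simp [h], fun _ => rfl⟩
    · obtain ⟨w, h1, h2⟩ := hF.exact (hz.supportedIn S) (hd S)
      exact ⟨w, h1, h2, fun h' => absurd h' h⟩
  choose w h1 h2 h3 using key
  exact ⟨w, inBidegree_of_supportedIn (fun S hS => hz.of_ne_zero fun h => hS (h3 S h)) h1, h2⟩

/-- The diagram chase in the tensor product of a resolution with the Koszul complex of the
variables. -/
theorem IsResolution.exists_eq_scalarD_add_modelD (hF : F.IsResolution I)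
    {z : Finset (Fin n) → F.B →₀ k} (hz : F.InBidegree m p q z)
    (hd : q ≠ 0 → ∃ z', F.InBidegree m (p + 1) (q - 1) z' ∧
      ∀ S, modelD (1 : Fin n → k) z S = F.scalarD (z' S))
    (hm : ∀ f, F.hdeg f = p + q → F.mdeg f ≠ m) :
    ∃ b c, F.InBidegree m (p + 1) q b ∧ F.InBidegree m p (q + 1) c ∧
      ∀ S, z S = F.scalarD (b S) + modelD (1 : Fin n → k) c S := by
  induction q generalizing p z with
  | zero =>
    obtain ⟨c, hc, hdc⟩ := hz.exists_modelD_eq (by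
      ext1 T
      by_contra h
      obtain ⟨i, hi, h⟩ := exists_insert_of_modelD_ne_zero h
      simpa using (hz.of_ne_zero h).1) (Or.inr hm)
    exact ⟨0, c, inBidegree_zero, hc, fun S => by simp [hdc]⟩
  | succ q ih =>
    obtain ⟨z', hz', hzz'⟩ := hd (by omega)
    rw [Nat.add_sub_cancel] at hz'
    -- The Koszul boundary of `z'` is killed by the differential of `F`, hence lies in its image by
    -- exactness in positive degree; so `z'` satisfies the induction hypothesis, with the same `p +
    -- q`.
    obtain ⟨a, b, -, hb, hab⟩ := ih hz' (fun hq => by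
      obtain ⟨q, rfl⟩ := Nat.exists_eq_succ_of_ne_zero hq
      obtain ⟨w, hw, hdw⟩ := hF.exists_scalarD_eq hz'.modelD fun S => by
        rw [← modelD_scalarD, ← funext hzz', modelD_modelD]; rfl
      exact ⟨w, hw, fun S => (hdw S).symm⟩) (fun f hf => hm f (by omega))
    -- Since `z' = d a + ∂ b`, one gets `∂ (z - d b) = d z' - d (∂ b) = d (d a) = 0`.
    have hcyc : modelD (1 : Fin n → k) (z - fun S => F.scalarD (b S)) = 0 := by
      ext1 T
      rw [map_sub, Pi.sub_apply, modelD_scalarD, hzz', hab, map_add, scalarD_scalarD, zero_add,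
        sub_self]
      rfl
    obtain ⟨c, hc, hdc⟩ := (hz.sub hb.scalarD).exists_modelD_eq hcyc (Or.inl (by omega))
    exact ⟨b, c, hb, hc, fun S => by rw [hdc]; simp⟩

/-- If `x^m ∉ J`, then `z` is an actual cycle and exactness over `R` applies. If `x^m ∈ J`, lift `z`
to `F₀` along the augmentation and chase. As no `m_f` equals `x^m`, the lift is a boundary from `F`
plus a Koszul boundary, and the augmentation sends the first summand into `I`. -/
theorem IsResolution.exists_sub_modelD_mem (hF : F.IsResolution I) (hI : IsMonomialIdeal I)
    (hI' : I ≠ ⊤) (hm : ∀ f, F.mdeg f = m → monomial m (1 : k) ∉ J)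
    {z : Finset (Fin n) → k} (hz : ∀ S, z S ≠ 0 → S.card = q + 1 ∧ squarefreeExp S ≤ m)
    (hdI : ∀ T, modelD (1 : Fin n → k) z T ≠ 0 → monomial (m - squarefreeExp T) (1 : k) ∈ I)
    (hdJ : ∀ T, modelD (1 : Fin n → k) z T ≠ 0 → monomial (m - squarefreeExp T) (1 : k) ∈ J) :
    ∃ w : Finset (Fin n) → k, (∀ S, w S ≠ 0 → S.card = q + 2 ∧ squarefreeExp S ≤ m) ∧
      ∀ S, z S - modelD (1 : Fin n → k) w S ≠ 0 → monomial (m - squarefreeExp S) (1 : k) ∈ I := by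
  by_cases hmJ : monomial m (1 : k) ∈ J
  swap
  · obtain ⟨w, hw, hdw⟩ := Quasitransverse.exists_modelD_eq hz (by
      ext1 T
      by_contra h
      exact hmJ (monomial_mem_of_le tsub_le_self one_ne_zero (hdJ T h) 1)) (Or.inl (by omega))
    exact ⟨w, hw, fun S hS => absurd (by rw [hdw, sub_self]) hS⟩
  obtain ⟨η, ⟨e, he, hem, heη⟩, hη⟩ := hF.exists_augmentation hI hI'
  -- This scaling makes `x ↦ c * x` on `e` a section of the augmentation.
  set c : k := (η (Finsupp.single e 1))⁻¹ with hc
  have hηe : ∀ x : k, η (Finsupp.single e (c * x)) = x := by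
    intro x
    rw [show Finsupp.single e (c * x) = (c * x) • Finsupp.single e (1 : k) by simp, map_smul,
      smul_eq_mul, hc]
    field_simp
  have hsupp : ∀ s (x : k), F.SupportedIn 0 s (Finsupp.single e x) := by
    intro s x f hf
    obtain rfl : e = f := by
      by_contra h
      exact hf (Finsupp.single_eq_of_ne' h)
    exact ⟨he, by simp [hem]⟩
  have hd0 : ∀ T, modelD (1 : Fin n → k) (fun S => Finsupp.single e (c * z S)) T =
      Finsupp.single e (c * modelD (1 : Fin n → k) z T) := fun T =>
    modelD_comp (1 : Fin n → k) (1 : Fin n → k)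
      ((Finsupp.singleAddHom e).comp (AddMonoidHom.mulLeft c)) (by simp) z T
  have hz0 : F.InBidegree m 0 (q + 1) (fun S => Finsupp.single e (c * z S)) :=
    inBidegree_of_supportedIn (fun S hS => hz S fun h => hS (by simp [h])) fun S => hsupp _ _
  have key : ∀ T, ∃ y, F.SupportedIn 1 (m - squarefreeExp T) y ∧
      F.scalarD y = modelD (1 : Fin n → k) (fun S => Finsupp.single e (c * z S)) T ∧
      (modelD (1 : Fin n → k) z T = 0 → y = 0) := by
    intro T
    by_cases h : modelD (1 : Fin n → k) z T = 0
    · exact ⟨0, supportedIn_zero _ _, by rw [hd0, h]; simp, fun _ => rfl⟩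
    · rw [hd0]
      obtain ⟨y, h1, h2⟩ := (hη _ _ (hsupp (m - squarefreeExp T)
        (c * modelD (1 : Fin n → k) z T))).1 (by
        rw [hηe]
        exact monomial_mem_of_le le_rfl one_ne_zero (hdI T h) _)
      exact ⟨y, h1, h2, fun h' => absurd h' h⟩
  choose y hy1 hy2 hy3 using key
  have hy : F.InBidegree m 1 q y := by
    refine inBidegree_of_supportedIn (fun T hT => ?_) hy1
    have h : modelD (1 : Fin n → k) z T ≠ 0 := fun h => hT (hy3 T h)
    obtain ⟨i, hi, h⟩ := exists_insert_of_modelD_ne_zero h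
    obtain ⟨h1, h2⟩ := hz _ h
    rw [Finset.card_insert_of_notMem hi] at h1
    exact ⟨by omega, (squarefreeExp_mono (Finset.subset_insert i T)).trans h2⟩
  obtain ⟨b, w, hb, hw, hbw⟩ := hF.exists_eq_scalarD_add_modelD hz0
    (fun _ => ⟨y, hy, fun S => (hy2 S).symm⟩) (fun f _ hf => hm f hf hmJ)
  refine ⟨fun S => η (w S), fun S hS => hw.of_ne_zero fun h => hS (by simp [h]), fun S hS => ?_⟩
  have h1 : modelD (1 : Fin n → k) (fun S => η (w S)) S = η (modelD (1 : Fin n → k) w S) :=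
    modelD_comp (1 : Fin n → k) (1 : Fin n → k) η.toAddMonoidHom (by simp) w S
  have h2 := congrArg η (hbw S)
  rw [hηe, map_add, ← h1] at h2
  rw [h2, add_sub_cancel_right] at hS
  exact monomial_mem_of_le le_rfl hS
    ((hη _ _ (hb.supportedIn S).scalarD).2 ⟨b S, hb.supportedIn S, rfl⟩) 1

end MultigradedComplex

end Strand

/-! ### Passage from single multidegrees to the Koszul complex of the quotient. -/

section Assembly

variable {n : ℕ} {k : Type u} [Field k]

/-- The scalar parts of the component of multidegree `m` of an element of the Koszul complex. -/
def koszulStrand (m : Fin n →₀ ℕ) (z : Finset (Fin n) → MvPolynomial (Fin n) k) :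
    Finset (Fin n) → k :=
  open Classical in
  fun S => if squarefreeExp S ≤ m then coeff (m - squarefreeExp S) (z S) else 0

theorem koszulStrand_sub (m : Fin n →₀ ℕ) (y z : Finset (Fin n) → MvPolynomial (Fin n) k) :
    koszulStrand m (y - z) = koszulStrand m y - koszulStrand m z := by
  ext S
  simp only [koszulStrand, Pi.sub_apply]
  split_ifs <;> simp

theorem koszulStrand_modelD (m : Fin n →₀ ℕ) (z : Finset (Fin n) → MvPolynomial (Fin n) k) :
    koszulStrand m (modelD (X : Fin n → MvPolynomial (Fin n) k) z) = modelD (1 : Fin n → k) (koszulStrand m z) := by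
  ext T
  by_cases hT : squarefreeExp T ≤ m
  · simp only [koszulStrand, hT, if_true, modelD_apply, lower_apply, coeff_sum, Pi.one_apply,
      one_smul]
    refine Finset.sum_congr rfl fun i _ => ?_
    by_cases hi : i ∈ T
    · simp [hi]
    · have hiff : squarefreeExp (insert i T) ≤ m ↔ i ∈ (m - squarefreeExp T).support := by
        rw [squarefreeExp_insert hi, Finsupp.mem_support_iff, add_comm,
          ← le_tsub_iff_right hT, Finsupp.single_le_iff, Nat.one_le_iff_ne_zero]
      simp only [hi, if_false, smul_eq_mul, mul_smul_comm, coeff_smul, coeff_X_mul', hiff]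
      rw [squarefreeExp_insert hi, tsub_add_eq_tsub_tsub]
  · rw [show koszulStrand m (modelD (X : Fin n → MvPolynomial (Fin n) k) z) T = 0 by simp [koszulStrand, hT]]
    by_contra h
    obtain ⟨i, hi, h⟩ := exists_insert_of_modelD_ne_zero (Ne.symm h)
    refine h (if_neg fun h' => hT ?_)
    exact (squarefreeExp_mono (Finset.subset_insert i T)).trans h'

theorem coeff_eq_koszulStrand (t : Fin n →₀ ℕ) (S : Finset (Fin n))
    (z : Finset (Fin n) → MvPolynomial (Fin n) k) :
    coeff t (z S) = koszulStrand (t + squarefreeExp S) z S := by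
  simp [koszulStrand]

theorem exists_koszulStrand_eq (ω : (Fin n →₀ ℕ) → Finset (Fin n) → k)
    (P : Finset (Fin n →₀ ℕ)) (hP : ∀ m ∉ P, ω m = 0)
    (hω : ∀ m S, ω m S ≠ 0 → squarefreeExp S ≤ m) :
    ∃ w : Finset (Fin n) → MvPolynomial (Fin n) k, (∀ m, koszulStrand m w = ω m) ∧
      ∀ S, w S ≠ 0 → ∃ m, ω m S ≠ 0 := by
  classical
  refine ⟨fun S => ∑ m ∈ P, monomial (m - squarefreeExp S) (ω m S), fun m => ?_, fun S hS => ?_⟩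
  · ext S
    simp only [koszulStrand]
    split_ifs with hS
    · simp only [coeff_sum, coeff_monomial]
      rw [Finset.sum_eq_single m]
      · simp
      · intro m' _ hm'
        split_ifs with h
        · by_contra h0
          exact hm' ((tsub_left_inj (hω m' S h0) hS).1 h)
        · rfl
      · intro hm
        simp [hP m hm]
    · by_contra h
      exact hS (hω m S (Ne.symm h))
  · obtain ⟨m, -, hm⟩ := Finset.exists_ne_zero_of_sum_ne_zero hS
    exact ⟨m, fun h => hm (by simp [h])⟩

variable {I J : Ideal (MvPolynomial (Fin n) k)} {F : MultigradedComplex n k} {q : ℕ}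

/-- The solutions in the separate multidegrees are glued. Choosing zero wherever the strand of `z`
is zero leaves finitely many, so they have a polynomial sum. -/
theorem exists_sub_modelD_X_mem (hF : F.IsResolution I) (hI : IsMonomialIdeal I)
    (hJ : IsMonomialIdeal J) (hI' : I ≠ ⊤) (hm : ∀ f, monomial (F.mdeg f) (1 : k) ∉ J)
    {z : Finset (Fin n) → MvPolynomial (Fin n) k} (hz : ∀ S, z S ≠ 0 → S.card = q + 1)
    (hd : ∀ T, modelD (X : Fin n → MvPolynomial (Fin n) k) z T ∈ I ⊓ J) :
    ∃ w : Finset (Fin n) → MvPolynomial (Fin n) k, (∀ S, w S ≠ 0 → S.card = q + 2) ∧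
      ∀ S, z S - modelD (X : Fin n → MvPolynomial (Fin n) k) w S ∈ I := by
  classical
  have hmem : ∀ {L : Ideal (MvPolynomial (Fin n) k)} (_ : IsMonomialIdeal L)
      (_ : ∀ T, modelD (X : Fin n → MvPolynomial (Fin n) k) z T ∈ L) (m : Fin n →₀ ℕ) (T : Finset (Fin n)),
      modelD (1 : Fin n → k) (koszulStrand m z) T ≠ 0 →
        monomial (m - squarefreeExp T) (1 : k) ∈ L := by
    intro L hL hd m T hT
    rw [← koszulStrand_modelD, koszulStrand] at hT
    split_ifs at hT with h
    · exact (hL.mem_iff _).1 (hd T) _ hT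
    · exact absurd rfl hT
  have key : ∀ m, ∃ w : Finset (Fin n) → k,
      (∀ S, w S ≠ 0 → S.card = q + 2 ∧ squarefreeExp S ≤ m) ∧
      (∀ S, koszulStrand m z S - modelD (1 : Fin n → k) w S ≠ 0 →
        monomial (m - squarefreeExp S) (1 : k) ∈ I) ∧ (koszulStrand m z = 0 → w = 0) := by
    intro m
    by_cases h0 : koszulStrand m z = 0
    · exact ⟨0, fun S h => absurd rfl h, fun S h => absurd (by simp [h0]) h, fun _ => rfl⟩
    · obtain ⟨w, h1, h2⟩ := hF.exists_sub_modelD_mem (m := m) (q := q) (J := J) hI hI'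
        (fun f hf => hf ▸ hm f) (z := koszulStrand m z)
        (fun S hS => by
          rw [koszulStrand] at hS
          split_ifs at hS with h
          · exact ⟨hz S fun h => hS (by simp [h]), h⟩
          · exact absurd rfl hS)
        (hmem hI (fun T => (hd T).1) m) (hmem hJ (fun T => (hd T).2) m)
      exact ⟨w, h1, h2, fun h => absurd h h0⟩
  choose ω h1 h2 h3 using key
  obtain ⟨w, hw, hw0⟩ := exists_koszulStrand_eq ω
    (Finset.univ.biUnion fun S => (z S).support.image (· + squarefreeExp S))
    (fun m hmP => h3 m (by
      ext S
      rw [koszulStrand]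
      split_ifs with h
      · by_contra h0
        refine hmP (Finset.mem_biUnion.2 ⟨S, Finset.mem_univ _, Finset.mem_image.2
          ⟨_, mem_support_iff.2 h0, tsub_add_cancel_of_le h⟩⟩)
      · rfl))
    (fun m S h => (h1 m S h).2)
  refine ⟨w, fun S hS => ?_, fun S => (hI.mem_iff _).2 fun t ht => ?_⟩
  · obtain ⟨m, hm⟩ := hw0 S hS
    exact (h1 m S hm).1
  · have h4 := coeff_eq_koszulStrand t S (z - modelD (X : Fin n → MvPolynomial (Fin n) k) w)
    rw [koszulStrand_sub, koszulStrand_modelD, hw] at h4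
    have h5 := h2 (t + squarefreeExp S) S (by
      rw [Pi.sub_apply] at h4
      exact fun h => ht (h4.trans h))
    rwa [add_tsub_cancel_right] at h5

/-- The variables in a quotient of the polynomial ring. -/
def quotientX (L : Ideal (MvPolynomial (Fin n) k)) (i : Fin n) : MvPolynomial (Fin n) k ⧸ L :=
  Ideal.Quotient.mk L (X i)

theorem mk_modelD (L : Ideal (MvPolynomial (Fin n) k))
    (z : Finset (Fin n) → MvPolynomial (Fin n) k) (T : Finset (Fin n)) :
    modelD (quotientX L) (fun S => Ideal.Quotient.mk L (z S)) T =
      Ideal.Quotient.mk L (modelD (X : Fin n → MvPolynomial (Fin n) k) z T) :=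
  modelD_comp (X : Fin n → MvPolynomial (Fin n) k) (quotientX L) (Ideal.Quotient.mk L).toAddMonoidHom
    (fun i v => by simp [quotientX]) z T

/-- Every cycle of positive degree of the Koszul complex of `R ⧸ (I ⊓ J)` becomes a boundary in
that of `R ⧸ I`. -/
theorem exists_sub_koszulD_mem (hF : F.IsResolution I) (hI : IsMonomialIdeal I)
    (hJ : IsMonomialIdeal J) (hI' : I ≠ ⊤) (hm : ∀ f, monomial (F.mdeg f) (1 : k) ∉ J)
    {L : Ideal (MvPolynomial (Fin n) k)} (hL : L = I ⊓ J)
    {x : ExteriorAlgebra (MvPolynomial (Fin n) k ⧸ L) (Fin n → MvPolynomial (Fin n) k ⧸ L)}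
    (hx : x ∈ koszulCycles (quotientX L) (q + 1)) :
    ∃ w ∈ ⋀[MvPolynomial (Fin n) k ⧸ L]^(q + 2) (Fin n → MvPolynomial (Fin n) k ⧸ L),
      x - koszulD (quotientX L) w ∈ I.map (Ideal.Quotient.mk L) •
        (⊤ : Submodule (MvPolynomial (Fin n) k ⧸ L) (ExteriorAlgebra (MvPolynomial (Fin n) k ⧸ L)
          (Fin n → MvPolynomial (Fin n) k ⧸ L))) := by
  classical
  have hcard := card_of_toModel_ne_zero hx.1
  have hker : modelD (quotientX L) (toModel x) = 0 := by
    rw [← toModel_koszulD, LinearMap.mem_ker.1 hx.2, map_zero]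
  -- Zero is lifted to zero, so that the lift keeps the homological degree of `x`.
  have hlift : ∀ S, ∃ p, Ideal.Quotient.mk L p = toModel x S ∧ (toModel x S = 0 → p = 0) := by
    intro S
    by_cases h : toModel x S = 0
    · exact ⟨0, by simp [h], fun _ => rfl⟩
    · obtain ⟨p, hp⟩ := Ideal.Quotient.mk_surjective (toModel x S)
      exact ⟨p, hp, fun h' => absurd h' h⟩
  choose z hz hz0 using hlift
  obtain ⟨w, hw, hzw⟩ := exists_sub_modelD_X_mem (q := q) hF hI hJ hI' hm (z := z)
    (fun S hS => hcard S fun h => hS (hz0 S h)) (fun T => by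
      rw [← hL, ← Ideal.Quotient.eq_zero_iff_mem, ← mk_modelD, funext hz]
      exact congrFun hker T)
  refine ⟨ofModel fun S => Ideal.Quotient.mk L (w S), ofModel_mem fun S hS => hw S fun h =>
    hS (by simp [h]), ?_⟩
  rw [← ofModel_toModel x, koszulD_ofModel, ← map_sub]
  refine ofModel_mem_smul_top fun S => ?_
  rw [Pi.sub_apply, mk_modelD, ← hz, ← map_sub]
  exact Ideal.mem_map_of_mem _ (hzw S)

end Assembly

/-! ### Consequences of the minimality of `F * G`. -/

section Minimality

namespace MultigradedComplex

variable {n : ℕ} {k : Type u} [Field k] {F G : MultigradedComplex n k}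
  {I J : Ideal (MvPolynomial (Fin n) k)}

/-- The multiple of `e` in multidegree `s` augments into `I`, so it is a boundary; some `f` in a
preimage has a nonzero coefficient at `e`. -/
theorem IsResolution.exists_generator (hF : F.IsResolution I) (hI : IsMonomialIdeal I)
    (hI' : I ≠ ⊤) {s : Fin n →₀ ℕ} (hs : monomial s (1 : k) ∈ I) :
    ∃ f e, F.hdeg e = 0 ∧ F.mdeg e = 0 ∧ F.coeff f e ≠ 0 ∧ F.mdeg f ≤ s := by
  obtain ⟨η, ⟨e, he, hem, -⟩, hη⟩ := hF.exists_augmentation hI hI'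
  obtain ⟨y, hy, hye⟩ := (hη s (Finsupp.single e 1) fun f hf => by
    obtain rfl : e = f := by
      by_contra h
      exact hf (Finsupp.single_eq_of_ne' h)
    exact ⟨he, by simp [hem]⟩).1 (monomial_mem_of_le le_rfl one_ne_zero hs _)
  obtain ⟨f, hf, hfe⟩ := F.exists_of_scalarD_ne_zero (y := y) (a := e) (by simp [hye])
  exact ⟨f, e, he, hem, hfe, (hy f hf).2⟩

theorem taylorCoeff_right {f : F.B} {g e : G.B} (h : G.coeff g e ≠ 0) :
    taylorCoeff F G (f, g) (f, e) ≠ 0 := by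
  have hge : e ≠ g := by
    rintro rfl
    have := G.hdeg_of_coeff_ne_zero _ _ h
    omega
  have h1 : ((F.coeff f).mapDomain (fun a => (a, g))) (f, e) = 0 :=
    Finsupp.mapDomain_of_notMem_range _ _ (by rintro ⟨x, hx⟩; exact hge (Prod.ext_iff.1 hx).2.symm)
  have h2 : ((G.coeff g).mapDomain (fun b => (f, b))) (f, e) = G.coeff g e :=
    Finsupp.mapDomain_apply (f := fun b => (f, b)) (fun x y hxy => (Prod.ext_iff.1 hxy).2) _ _
  simp [taylorCoeff, h1, h2, h]

theorem taylorCoeff_left {f e : F.B} {g : G.B} (h : F.coeff f e ≠ 0) :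
    taylorCoeff F G (f, g) (e, g) ≠ 0 := by
  have hfe : e ≠ f := by
    rintro rfl
    have := F.hdeg_of_coeff_ne_zero _ _ h
    omega
  have h1 : ((G.coeff g).mapDomain (fun b => (f, b))) (e, g) = 0 :=
    Finsupp.mapDomain_of_notMem_range _ _ (by rintro ⟨x, hx⟩; exact hfe (Prod.ext_iff.1 hx).1.symm)
  have h2 : ((F.coeff f).mapDomain (fun a => (a, g))) (e, g) = F.coeff f e :=
    Finsupp.mapDomain_apply (f := fun a => (a, g)) (fun x y hxy => (Prod.ext_iff.1 hxy).1) _ _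
  simp [taylorCoeff, h1, h2, h]

/-- If `m_f ∈ J`, some generator `m_g` of `J` divides `m_f`. Then `f * g` and `f * e` have the same
multidegree `m_f`, and a nonzero scalar joins them in the differential. -/
theorem monomial_mdeg_notMem_right (hG : G.IsResolution J) (hJ : IsMonomialIdeal J) (hJ' : J ≠ ⊤)
    (hmin : (F.taylor G).IsMinimal) (f : F.B) : monomial (F.mdeg f) (1 : k) ∉ J := by
  intro h
  obtain ⟨g, e, -, hem, hge, hle⟩ := hG.exists_generator hJ hJ' h
  refine hmin.mdeg_ne (f := (f, g)) (a := (f, e)) (taylorCoeff_right hge) ?_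
  simp [taylor, hem, hle]

theorem monomial_mdeg_notMem_left (hF : F.IsResolution I) (hI : IsMonomialIdeal I) (hI' : I ≠ ⊤)
    (hmin : (F.taylor G).IsMinimal) (g : G.B) : monomial (G.mdeg g) (1 : k) ∉ I := by
  intro h
  obtain ⟨f, e, -, hem, hfe, hle⟩ := hF.exists_generator hI hI' h
  refine hmin.mdeg_ne (f := (f, g)) (a := (e, g)) (taylorCoeff_left hfe) ?_
  simp [taylor, hem, hle]

/-- If `x_i ∈ I`, a generator `m_f ≠ 1` divides `x_i`, so it equals `x_i`; then `m_f ∉ J` excludes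
`x_i ∈ J`. -/
theorem IsMinimalResolution.X_notMem (hF : F.IsMinimalResolution I) (hI : IsMonomialIdeal I)
    (hI' : I ≠ ⊤) (hm : ∀ f, monomial (F.mdeg f) (1 : k) ∉ J) (i : Fin n) :
    monomial (Finsupp.single i 1) (1 : k) ∉ I ⊓ J := by
  rintro ⟨h1, h2⟩
  obtain ⟨f, e, -, hem, hfe, hle⟩ := hF.1.exists_generator hI hI' h1
  have h0 := hF.2.mdeg_ne hfe
  rw [hem] at h0
  obtain ⟨j, hj⟩ := Finsupp.ne_iff.1 h0
  refine hm f ?_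
  suffices h : F.mdeg f = Finsupp.single i 1 by rw [h]; exact h2
  refine le_antisymm hle ?_
  rw [Finsupp.single_le_iff]
  have := hle j
  by_cases hij : i = j
  · subst hij
    exact Nat.one_le_iff_ne_zero.2 (Ne.symm hj)
  · rw [Finsupp.single_eq_of_ne' hij] at this
    exact absurd (Nat.le_zero.1 this).symm hj

end MultigradedComplex

end Minimality

/-! ### Massey operations from two ideals with zero product. -/

section Massey

variable {n : ℕ} {A : Type u} [CommRing A] (a : Fin n → A)

theorem exteriorPower_mul_mem {p q : ℕ} {x y : ExteriorAlgebra A (Fin n → A)}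
    (hx : x ∈ ⋀[A]^p (Fin n → A)) (hy : y ∈ ⋀[A]^q (Fin n → A)) :
    x * y ∈ ⋀[A]^(p + q) (Fin n → A) := by
  have := Submodule.mul_mem_mul hx hy
  rwa [← pow_add] at this

theorem koszulD_mem {q : ℕ} {x : ExteriorAlgebra A (Fin n → A)}
    (hx : x ∈ ⋀[A]^(q + 1) (Fin n → A)) : koszulD a x ∈ ⋀[A]^q (Fin n → A) := by
  induction q generalizing x with
  | zero =>
    rw [exteriorPower_succ] at hx
    induction hx using Submodule.mul_induction_on' with
    | mem_mul_mem v hv y hy =>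
      obtain ⟨v, rfl⟩ := hv
      have hy' := hy
      rw [exteriorPower_zero, Submodule.mem_one] at hy'
      obtain ⟨c, rfl⟩ := hy'
      rw [koszulD_ι_mul, koszulD_algebraMap, mul_zero, sub_zero]
      exact Submodule.smul_mem _ _ hy
    | add x _ y _ hx hy => rw [map_add]; exact Submodule.add_mem _ hx hy
  | succ q ih =>
    rw [exteriorPower_succ] at hx
    induction hx using Submodule.mul_induction_on' with
    | mem_mul_mem v hv y hy =>
      obtain ⟨v, rfl⟩ := hv
      rw [koszulD_ι_mul]
      refine Submodule.sub_mem _ (Submodule.smul_mem _ _ hy) ?_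
      rw [exteriorPower_succ]
      exact Submodule.mul_mem_mul ⟨v, rfl⟩ (ih hy)
    | add x _ y _ hx hy => rw [map_add]; exact Submodule.add_mem _ hx hy

theorem koszulD_mul {q : ℕ} {x : ExteriorAlgebra A (Fin n → A)} (hx : x ∈ ⋀[A]^q (Fin n → A))
    (y : ExteriorAlgebra A (Fin n → A)) :
    koszulD a (x * y) = koszulD a x * y + (-1 : A) ^ q • (x * koszulD a y) := by
  induction q generalizing x with
  | zero =>
    rw [exteriorPower_zero, Submodule.mem_one] at hx
    obtain ⟨c, rfl⟩ := hx
    rw [koszulD_algebraMap, zero_mul, zero_add, pow_zero, one_smul, ← Algebra.smul_def,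
      ← Algebra.smul_def, map_smul]
  | succ q ih =>
    rw [exteriorPower_succ] at hx
    induction hx using Submodule.mul_induction_on' with
    | mem_mul_mem v hv x hx =>
      obtain ⟨v, rfl⟩ := hv
      rw [mul_assoc, koszulD_ι_mul, koszulD_ι_mul, ih hx, sub_mul, mul_add, smul_mul_assoc,
        mul_smul_comm, mul_assoc, mul_assoc, pow_succ, mul_neg_one, neg_smul]
      abel
    | add x _ x' _ hx hx' =>
      rw [add_mul, map_add, hx, hx', map_add, add_mul, add_mul, smul_add]
      abel

theorem mul_mem_smul_top {𝔞 : Ideal A} {x : ExteriorAlgebra A (Fin n → A)}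
    (hx : x ∈ 𝔞 • (⊤ : Submodule A (ExteriorAlgebra A (Fin n → A))))
    (y : ExteriorAlgebra A (Fin n → A)) :
    x * y ∈ 𝔞 • (⊤ : Submodule A (ExteriorAlgebra A (Fin n → A))) := by
  induction hx using Submodule.smul_induction_on' with
  | smul r hr x _ =>
    rw [smul_mul_assoc]
    exact Submodule.smul_mem_smul hr trivial
  | add x _ x' _ hx hx' => rw [add_mul]; exact Submodule.add_mem _ hx hx'

theorem mul_eq_zero_of_mem_smul_top {𝔞 𝔟 : Ideal A} (h : 𝔞 * 𝔟 = ⊥)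
    {x y : ExteriorAlgebra A (Fin n → A)}
    (hx : x ∈ 𝔞 • (⊤ : Submodule A (ExteriorAlgebra A (Fin n → A))))
    (hy : y ∈ 𝔟 • (⊤ : Submodule A (ExteriorAlgebra A (Fin n → A)))) : x * y = 0 := by
  induction hx using Submodule.smul_induction_on' with
  | smul r hr x _ =>
    induction hy using Submodule.smul_induction_on' with
    | smul r' hr' y _ =>
      have h0 : r * r' = 0 := by
        have := Ideal.mul_mem_mul hr hr'
        rwa [h] at this
      rw [smul_mul_smul_comm, h0, zero_smul]
    | add y _ y' _ hy hy' => rw [mul_add, hy, hy', add_zero]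
  | add x _ x' _ hx hx' => rw [add_mul, hx, hx', add_zero]

variable {Λ : ℕ → Type u} (z w : (Σ i, Λ i) → ExteriorAlgebra A (Fin n → A))

/-- The Massey operation `(h₁, …, h_p) ↦ z(h₁) w(h₂) ⋯ w(h_p)`. -/
def masseyProduct : List (Σ i, Λ i) → ExteriorAlgebra A (Fin n → A)
  | [] => 0
  | h :: t => z h * (t.map w).prod

/-- The summand `p - 1` is shared out, one to each entry after the first, in agreement with `w`
raising the degree by one. -/
theorem masseyDegree_cons (h : Σ i, Λ i) (t : List (Σ i, Λ i)) :
    masseyDegree (h :: t) = h.1 + 1 + (t.map fun h => h.1 + 2).sum := by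
  have : (t.map fun h : Σ i, Λ i => h.1 + 2).sum = (t.map fun h => h.1 + 1).sum + t.length := by
    induction t with
    | nil => rfl
    | cons h t ih => simp only [List.map_cons, List.sum_cons, ih, List.length_cons]; omega
  simp only [masseyDegree, List.map_cons, List.sum_cons, List.length_cons, this]
  omega

variable {z w}

theorem prod_map_mem (hw : ∀ h, w h ∈ ⋀[A]^(h.1 + 2) (Fin n → A)) (t : List (Σ i, Λ i)) :
    (t.map w).prod ∈ ⋀[A]^((t.map fun h => h.1 + 2).sum) (Fin n → A) := by
  induction t with
  | nil => simp
  | cons h t ih =>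
    simp only [List.map_cons, List.prod_cons, List.sum_cons]
    exact exteriorPower_mul_mem (hw h) ih

/-- In the Leibniz rule `d (w h)` may be replaced by `-z h`: the error lies in `𝔟 K` and is killed
by the prefix, which lies in `𝔞 K`. The prefix `x` is general so that the induction can absorb `w h`
into it. -/
theorem koszulD_mul_prod {𝔞 𝔟 : Ideal A} (hab : 𝔞 * 𝔟 = ⊥)
    (hw : ∀ h, w h ∈ ⋀[A]^(h.1 + 2) (Fin n → A))
    (hwz : ∀ h, koszulD a (w h) + z h ∈ 𝔟 • (⊤ : Submodule A (ExteriorAlgebra A (Fin n → A))))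
    (t : List (Σ i, Λ i)) {q : ℕ} {x : ExteriorAlgebra A (Fin n → A)}
    (hx : x ∈ ⋀[A]^q (Fin n → A))
    (hxa : x ∈ 𝔞 • (⊤ : Submodule A (ExteriorAlgebra A (Fin n → A)))) :
    koszulD a (x * (t.map w).prod) = koszulD a x * (t.map w).prod +
      ∑ j ∈ Finset.range t.length, (-1 : A) ^ (q + ((t.take j).map fun h => h.1 + 2).sum + 1) •
        (x * ((t.take j).map w).prod * masseyProduct z w (t.drop j)) := by
  induction t generalizing q x with
  | nil => simp
  | cons h t ih =>
    have h0 : x * koszulD a (w h) = -(x * z h) := by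
      rw [eq_neg_iff_add_eq_zero, ← mul_add]
      exact mul_eq_zero_of_mem_smul_top hab hxa (hwz h)
    rw [List.map_cons, List.prod_cons, ← mul_assoc,
      ih (exteriorPower_mul_mem hx (hw h)) (mul_mem_smul_top hxa _), koszulD_mul a hx, h0,
      List.length_cons, Finset.sum_range_succ', add_mul, mul_assoc (koszulD a x), add_assoc]
    congr 1
    rw [add_comm]
    congr 1
    · refine Finset.sum_congr rfl fun j _ => ?_
      simp only [List.take_succ_cons, List.drop_succ_cons, List.map_cons, List.sum_cons,
        List.prod_cons, mul_assoc, add_assoc]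
    · simp [masseyProduct, pow_succ, mul_assoc]

/-- If every homology class of positive degree of the Koszul complex becomes zero both modulo `𝔞`
and modulo `𝔟`, where `𝔞 𝔟 = 0`, then there is a trivial Massey operation. -/
theorem hasTrivialMasseyOperation_of_mul_eq_bot (k : Type u) [Field k] [Algebra k A]
    {𝔞 𝔟 : Ideal A} (hab : 𝔞 * 𝔟 = ⊥)
    (ha : ∀ q, ∀ x ∈ koszulCycles a (q + 1), ∃ u ∈ ⋀[A]^(q + 2) (Fin n → A),
      x - koszulD a u ∈ 𝔞 • (⊤ : Submodule A (ExteriorAlgebra A (Fin n → A))))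
    (hb : ∀ q, ∀ x ∈ koszulCycles a (q + 1), ∃ u ∈ ⋀[A]^(q + 2) (Fin n → A),
      x - koszulD a u ∈ 𝔟 • (⊤ : Submodule A (ExteriorAlgebra A (Fin n → A)))) :
    HasTrivialMasseyOperation a k := by
  let b := fun i => Module.Basis.ofVectorSpace k (KoszulHomology a (i + 1))
  have key : ∀ h : Σ i, Module.Basis.ofVectorSpaceIndex k (KoszulHomology a (i + 1)),
      ∃ (z : ExteriorAlgebra A (Fin n → A)) (hz : z ∈ koszulCycles a (h.1 + 1)),
        Submodule.Quotient.mk ⟨z, hz⟩ = b h.1 h.2 ∧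
        z ∈ 𝔞 • (⊤ : Submodule A (ExteriorAlgebra A (Fin n → A))) := by
    intro h
    obtain ⟨⟨x, hx⟩, hxb⟩ := Submodule.Quotient.mk_surjective _ (b h.1 h.2)
    obtain ⟨u, hu, hxu⟩ := ha h.1 x hx
    have hdu : koszulD a u ∈ koszulCycles a (h.1 + 1) :=
      ⟨koszulD_mem a hu, koszulD_koszulD a u⟩
    refine ⟨x - koszulD a u, Submodule.sub_mem _ hx hdu, ?_, hxu⟩
    rw [← hxb, Submodule.Quotient.eq, Submodule.submoduleOf, Submodule.mem_comap]
    refine ⟨-u, Submodule.neg_mem _ hu, ?_⟩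
    simp
  choose z hz hzb hza using key
  -- The sign `d w ≡ -z` accounts for the `+ 1` in the exponent of the bar.
  have key' : ∀ h, ∃ w ∈ ⋀[A]^(h.1 + 2) (Fin n → A),
      koszulD a w + z h ∈ 𝔟 • (⊤ : Submodule A (ExteriorAlgebra A (Fin n → A))) := by
    intro h
    obtain ⟨u, hu, hzu⟩ := hb h.1 (z h) (hz h)
    refine ⟨-u, Submodule.neg_mem _ hu, ?_⟩
    rwa [map_neg, neg_add_eq_sub]
  choose w hw hwz using key'
  refine ⟨_, b, masseyProduct z w, fun l hl => ?_, fun h => ?_, fun l hl => ?_⟩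
  · obtain ⟨h, t, rfl⟩ := List.exists_cons_of_ne_nil hl
    rw [masseyDegree_cons]
    exact exteriorPower_mul_mem (hz h).1 (prod_map_mem hw t)
  · have : masseyProduct z w [h] = z h := by simp [masseyProduct]
    simp only [this]
    exact ⟨hz h, hzb h⟩
  · obtain ⟨h, t, rfl⟩ := List.exists_cons_of_ne_nil hl
    rw [masseyProduct, koszulD_mul_prod a hab hw hwz t (hz h).1 (hza h),
      LinearMap.mem_ker.1 (hz h).2, zero_mul, zero_add, Finset.sum_Ico_eq_sum_range]
    refine Finset.sum_congr (by simp) fun j _ => ?_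
    rw [add_comm 1 j, List.take_succ_cons, List.drop_succ_cons, masseyDegree_cons, masseyProduct]

end Massey

/-! ### The variables as a minimal system of generators. -/

section EmbeddingDimension

variable {n : ℕ} {k : Type u} [Field k] {L : Ideal (MvPolynomial (Fin n) k)}

theorem coeff_single_one_mul (i : Fin n) (p q : MvPolynomial (Fin n) k) :
    coeff (Finsupp.single i 1) (p * q) =
      coeff 0 p * coeff (Finsupp.single i 1) q + coeff (Finsupp.single i 1) p * coeff 0 q := by
  classical
  rw [coeff_mul, Finsupp.antidiagonal_single]
  simp [Finset.Nat.antidiagonal_succ]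

theorem coeff_zero_of_mk_mem (h0 : ∀ p ∈ L, coeff 0 p = 0) {p : MvPolynomial (Fin n) k}
    (hp : Ideal.Quotient.mk L p ∈ (idealOfVars (Fin n) k).map (Ideal.Quotient.mk L)) :
    coeff 0 p = 0 := by
  rw [Ideal.mem_map_iff_of_surjective _ Ideal.Quotient.mk_surjective] at hp
  obtain ⟨q, hq, hqp⟩ := hp
  have := h0 _ (Ideal.Quotient.eq.1 hqp)
  rw [coeff_sub, coeff_zero_of_mem_idealOfVars hq, zero_sub, neg_eq_zero] at this
  exact this

theorem bijective_algebraMap_quotient (h0 : ∀ p ∈ L, coeff 0 p = 0) :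
    Function.Bijective (algebraMap k ((MvPolynomial (Fin n) k ⧸ L) ⧸
      (idealOfVars (Fin n) k).map (Ideal.Quotient.mk L))) := by
  have hne : (idealOfVars (Fin n) k).map (Ideal.Quotient.mk L) ≠ ⊤ := by
    intro h
    have h1 := coeff_zero_of_mk_mem h0 (p := 1) (by rw [h]; trivial)
    simp at h1
  have := Ideal.Quotient.nontrivial_iff.2 hne
  refine ⟨RingHom.injective _, fun y => ?_⟩
  obtain ⟨y, rfl⟩ := Ideal.Quotient.mk_surjective y
  obtain ⟨p, rfl⟩ := Ideal.Quotient.mk_surjective y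
  refine ⟨coeff 0 p, ?_⟩
  change Ideal.Quotient.mk _ (Ideal.Quotient.mk L (C (coeff 0 p))) = _
  rw [Ideal.Quotient.eq, ← map_sub]
  refine Ideal.mem_map_of_mem _ ?_
  rw [← pow_one (idealOfVars (Fin n) k), mem_pow_idealOfVars_iff']
  intro x hx
  obtain rfl : x = 0 := (Finsupp.degree_eq_zero_iff x).1 (by omega)
  simp

theorem map_idealOfVars_eq_span (L : Ideal (MvPolynomial (Fin n) k)) :
    (idealOfVars (Fin n) k).map (Ideal.Quotient.mk L) = Ideal.span (Set.range (quotientX L)) := by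
  rw [idealOfVars, Ideal.map_span, ← Set.range_comp]
  rfl

/-- Linear parts are well defined modulo `L`. On the maximal ideal, multiplying by `r` scales them
by the constant term of `r`; hence the linear parts of any generators span `k^n`. -/
theorem spanFinrank_map_idealOfVars (h0 : ∀ p ∈ L, coeff 0 p = 0)
    (h1 : ∀ p ∈ L, ∀ i, coeff (Finsupp.single i 1) p = 0) :
    ((idealOfVars (Fin n) k).map (Ideal.Quotient.mk L)).spanFinrank = n := by
  apply le_antisymm
  · rw [map_idealOfVars_eq_span]
    refine (Submodule.spanFinrank_span_le_ncard_of_finite (Set.finite_range _)).trans ?_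
    rw [← Set.image_univ]
    refine (Set.ncard_image_le Set.finite_univ).trans ?_
    simp
  · obtain ⟨s, hs, hspan⟩ := Submodule.FG.exists_span_finset_card_eq_spanFinrank
      ((idealOfVars_fg (Fin n) k).map (Ideal.Quotient.mk L))
    classical
    let φ : MvPolynomial (Fin n) k →ₗ[k] (Fin n → k) :=
      LinearMap.pi fun i => lcoeff k (Finsupp.single i 1)
    have hφ : ∀ p q, Ideal.Quotient.mk L p = Ideal.Quotient.mk L q → φ p = φ q := by
      intro p q hpq
      rw [← sub_eq_zero, ← map_sub]
      ext i
      exact h1 _ (Ideal.Quotient.eq.1 hpq) i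
    -- `g` is only a set-theoretic section; `hφ` makes `φ (g y)` independent of the choice.
    choose g hg using Ideal.Quotient.mk_surjective (I := L)
    have key : ∀ y ∈ Submodule.span (MvPolynomial (Fin n) k ⧸ L)
        (s : Set (MvPolynomial (Fin n) k ⧸ L)),
        φ (g y) ∈ Submodule.span k ((s.image fun y => φ (g y) : Finset (Fin n → k)) :
          Set (Fin n → k)) := by
      intro y hy
      induction hy using Submodule.span_induction with
      | mem y hy => exact Submodule.subset_span (by simpa using ⟨y, hy, rfl⟩)
      | zero =>
        rw [hφ (g 0) 0 (by rw [hg, map_zero]), map_zero]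
        exact Submodule.zero_mem _
      | add x y _ _ hx hy =>
        rw [hφ (g (x + y)) (g x + g y) (by simp [hg]), map_add]
        exact Submodule.add_mem _ hx hy
      | smul r y hys hy =>
        have h2 : coeff 0 (g y) = 0 := by
          refine coeff_zero_of_mk_mem h0 ?_
          rw [hg, ← hspan]
          exact hys
        have h3 : φ (g (r • y)) = coeff 0 (g r) • φ (g y) := by
          rw [hφ (g (r • y)) (g r * g y) (by simp [hg])]
          ext i
          change coeff _ (g r * g y) = coeff 0 (g r) * coeff _ (g y)
          rw [coeff_single_one_mul, h2, mul_zero, add_zero]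
        rw [h3]
        exact Submodule.smul_mem _ _ hy
    have htop : Submodule.span k ((s.image fun y => φ (g y) : Finset (Fin n → k)) :
        Set (Fin n → k)) = ⊤ := by
      rw [eq_top_iff, ← (Pi.basisFun k (Fin n)).span_eq, Submodule.span_le]
      rintro _ ⟨i, rfl⟩
      have h2 := key (quotientX L i) (by
        rw [hspan]
        exact Ideal.mem_map_of_mem _ (Ideal.subset_span ⟨i, rfl⟩))
      have h3 : φ (g (quotientX L i)) = Pi.basisFun k (Fin n) i := by
        rw [hφ (g (quotientX L i)) (X i) (hg _)]
        ext j
        change coeff _ (X i) = _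
        rw [MvPolynomial.coeff_X]
        simp [Pi.single_apply, Finsupp.single_left_inj, eq_comm]
      rwa [h3] at h2
    have hcard := finrank_span_finset_le_card (R := k) (s.image fun y => φ (g y))
    rw [Set.finrank, htop, finrank_top, Module.finrank_fin_fun] at hcard
    exact hcard.trans (Finset.card_image_le.trans hs.le)

end EmbeddingDimension

end

end Quasitransverse

theorem proposition6p1 {n : ℕ} {k : Type*} [Field k] (I J : Ideal (MvPolynomial (Fin n) k))
    (hI : I ≠ ⊤) (hJ : J ≠ ⊤) (hIJ : Quasitransverse.IsQuasitransverse I J) :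
    Quasitransverse.IsGolodRing k (MvPolynomial (Fin n) k ⧸ (I ⊓ J))
      ((MvPolynomial.idealOfVars (Fin n) k).map (Ideal.Quotient.mk (I ⊓ J))) := by
  open Quasitransverse MultigradedComplex in
  obtain ⟨hI', hJ', F, G, hF, hG, -, hmin⟩ := hIJ
  have hFm := monomial_mdeg_notMem_right hG.1 hJ' hJ hmin
  have hGm := monomial_mdeg_notMem_left hF.1 hI' hI hmin
  have h0 : ∀ p ∈ I ⊓ J, coeff 0 p = 0 := fun p hp => hI'.coeff_zero hI hp.1
  have h1 : ∀ p ∈ I ⊓ J, ∀ i, coeff (Finsupp.single i 1) p = 0 := by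
    intro p hp i
    by_contra h
    exact hF.X_notMem hI' hI hFm i ⟨(hI'.mem_iff p).1 hp.1 _ h, (hJ'.mem_iff p).1 hp.2 _ h⟩
  refine ⟨bijective_algebraMap_quotient h0, ?_⟩
  have hab : I.map (Ideal.Quotient.mk (I ⊓ J)) * J.map (Ideal.Quotient.mk (I ⊓ J)) = ⊥ := by
    rw [← Ideal.map_mul, Ideal.map_eq_bot_iff_le_ker, Ideal.mk_ker]
    exact Ideal.mul_le_inf
  have hmassey : HasTrivialMasseyOperation (quotientX (I ⊓ J)) k :=
    hasTrivialMasseyOperation_of_mul_eq_bot _ k hab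
      (fun q x hx => exists_sub_koszulD_mem hF.1 hI' hJ' hI hFm rfl hx)
      (fun q x hx => exists_sub_koszulD_mem hG.1 hJ' hI' hJ hGm (inf_comm I J) hx)
  -- The minimal number of generators becomes `n`, so the family of variables has the required index
  -- type.
  rw [spanFinrank_map_idealOfVars h0 h1]
  exact ⟨quotientX (I ⊓ J), (map_idealOfVars_eq_span _).symm, hmassey⟩
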